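/- For $n\ge 1$ let $P_n(\theta)=\prod_{k=1}^n(1-e^{ik\theta})$, $\theta\in\mathbb{R}/2\pi\mathbb{Z}$. For $1\le p<\infty$ let $\|P_n\|_p=\Big(\frac1{2\pi}\int_0^{2\pi}|P_n(\theta)|^p\,d\theta\Big)^{1/p}$, and let $\|P_n\|_\infty=\sup_\theta|P_n(\theta)|$. The function $w\mapsto w^{-1}\int_0^w\log\sin(\pi t)\,dt$ attains its maximum over $0<w<1$ at exactly one point $w_0\in(0,1)$. Put \[ K=\log 2+\max_{0<w<1}\Big(w^{-1}\int_0^w\log\sin(\pi t)\,dt\Big)=\log 2+w_0^{-1}\int_0^{w_0}\log\sin(\pi t)\,dt . \] Then $1-\tfrac14e^{2K}>0$ and $-\cot(\pi w_0)>0$. Put \[ B=2e^K\Big(1-\tfrac14e^{2K}\Big)^{-1/4},\qquad C>0,\quad C^2=-\frac12\,\frac{\pi}{w_0}\cot(\pi w_0). \] Then for each real $p$ with $1\le p<\infty$, as $n\to\infty$, \[ \|P_n\|_p\sim\Big(2\,\frac{\pi^{1/2}}{C\,p^{1/2}\,n^{3/2}}\Big)^{1/p}e^{Kn}\,BC\,\Big(\frac{n}{4\pi}\Big)^{1/2},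 \] and \[ \|P_n\|_\infty\sim e^{Kn}\,BC\,\Big(\frac{n}{4\pi}\Big)^{1/2}. \] -/

import Mathlib

open Filter Asymptotics Set

/-- `P_n(θ) = ∏_{k=1}^n (1 - e^{ikθ})`. -/
noncomputable def sudlerProduct (n : ℕ) (θ : ℝ) : ℂ :=
  ∏ k ∈ Finset.Icc 1 n, (1 - Complex.exp (Complex.I * (k : ℂ) * (θ : ℂ)))

/-- The `L^p` norm on the circle with normalized measure,
`((1/2π) ∫_0^{2π} |f(θ)|^p dθ)^{1/p}`, for `1 ≤ p < ∞`. -/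
noncomputable def circleLpNorm (p : ℝ) (f : ℝ → ℂ) : ℝ :=
  ((1 / (2 * Real.pi)) * ∫ θ in (0 : ℝ)..(2 * Real.pi), ‖f θ‖ ^ p) ^ (1 / p)

/-- The `L^∞` norm on the circle of a bounded continuous `2π`-periodic function (for such functions
the supremum and the essential supremum agree). -/
noncomputable def circleSupNorm (f : ℝ → ℂ) : ℝ :=
  ⨆ θ : ℝ, ‖f θ‖

/-- `w⁻¹ ∫_0^w log sin(πt) dt`. -/
noncomputable def meanLogSin (w : ℝ) : ℝ :=
  w⁻¹ * ∫ t in (0 : ℝ)..w, Real.log (Real.sin (Real.pi * t))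

/-- The supremum in `circleSupNorm (sudlerProduct n)` is over a bounded set. -/
theorem bddAbove_norm_sudlerProduct (n : ℕ) :
    BddAbove (range fun θ : ℝ => ‖sudlerProduct n θ‖) := by
  refine ⟨2 ^ n, ?_⟩
  rintro _ ⟨θ, rfl⟩
  simp only [sudlerProduct, norm_prod]
  calc ∏ k ∈ Finset.Icc 1 n, ‖1 - Complex.exp (Complex.I * (k : ℂ) * (θ : ℂ))‖
      ≤ ∏ _k ∈ Finset.Icc 1 n, (2 : ℝ) := by
        refine Finset.prod_le_prod (fun _ _ => norm_nonneg _) fun k _ => ?_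
        refine (norm_sub_le _ _).trans ?_
        have : ‖Complex.exp (Complex.I * (k : ℂ) * (θ : ℂ))‖ = 1 := by
          have h := Complex.norm_exp_ofReal_mul_I ((k : ℝ) * θ)
          rw [← h]
          congr 2
          push_cast
          ring
        rw [this, norm_one]
        norm_num
    _ = 2 ^ n := by simp

/-!
Write `G(w) = ∫_0^w log |2 sin πt| dt` (`logSinIntegral`), so that `log 2 + meanLogSin w = G(w) / w`.
At `θ = 2πw/n` with `0 < w < 1` the product `|P_n(θ)| = ∏_{k ≤ n} |2 sin (kθ/2)|` is a Riemann sum in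
the exponent, and Stirling's formula (for the singularity `log t` at `0`) with the trapezoidal rule
(for the smooth part `log (sin πt / πt)`) give, uniformly in `0 < w ≤ b` for each `b < 1`,
`|P_n(2πw/n)| = e^{n G(w)/w} (2n sin(πw)/w)^{1/2} (1 + o(1))` (`exists_log_prod_bound`).

The exponent `G(w)/w` has a unique maximum over all `w > 0`: its derivative is `H(w)/w²` with
`H = w G' - G` and `H' = πw cot πw`, which is negative beyond `1/2`, while `G ≤ 0` on `[0, 1/2]`; for
`w ≥ 1` one uses that `G` has period `1` (`exists_rate_max`). At the critical point `w₀` one has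
`e^K = 2 sin πw₀`, and the second-order coefficient of `G(w)/w` is `-C²` (`tendsto_rate_sub_div_sq`).

The remaining point is that no other `θ` matters: unless `n|θ|/2π` is near `w₀` (for `|θ| ≤ π`), the
product is at most `e^{(K-δ)n}` (`exists_uniform_bound`). Suppose not, and take limits along an
ultrafilter of counterexamples `z = e^{iθ}`. After replacing `log |1 - z|` by its majorant
`log (2/(1+r)) + log |1 - rz|`, whose Fourier series converges absolutely, the growth rate depends
only on the limits of the means of `z^{mk}` over `k ≤ n`. Such a mean tends to `0` if
`n|z^m - 1| → ∞`. If this happens for all `m ≥ 1`, the rate is `0`. Otherwise let `q` be the least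
exception: only multiples of `q` contribute, and as `r → 1` the rate becomes `G(s)/(qs)` with
`s = lim n|arg z^q|/2π` (it is `≤ 0` for `s = 0`), which is less than `K` unless `q = 1` and `s = w₀`
(`exists_rate_lt`).

The supremum norm is then the value at `w₀`, and Laplace's method with `w = w₀ + u/√n` gives the `L^p`
norm, the factor `2` accounting for the peaks at `θ` and `-θ` (`tendsto_circleSupNorm_div`,
`tendsto_integral_rescaled`).
-/

namespace Sudler

open Real MeasureTheory Topology

/-! ### The rate function -/

/-- `∫_0^w log (2 sin πt) dt`. As `Real.log x = log |x|`, the integrand is `log |2 sin πt|` for all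
real `t`. -/
noncomputable def logSinIntegral (w : ℝ) : ℝ :=
  ∫ t in (0 : ℝ)..w, log (2 * sin (π * t))

lemma intervalIntegrable_log_two_mul_sin (a b : ℝ) :
    IntervalIntegrable (fun t => log (2 * sin (π * t))) volume a b := by
  have h : AnalyticOnNhd ℝ (fun t : ℝ => 2 * sin (π * t)) univ := by
    intro x _
    fun_prop
  exact (h.mono (subset_univ _)).meromorphicOn.intervalIntegrable_log

lemma intervalIntegrable_log_sin_pi_mul (a b : ℝ) :
    IntervalIntegrable (fun t => log (sin (π * t))) volume a b := by
  have h : AnalyticOnNhd ℝ (fun t : ℝ => sin (π * t)) univ := by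
    intro x _
    fun_prop
  exact (h.mono (subset_univ _)).meromorphicOn.intervalIntegrable_log

lemma sin_pi_mul_pos {t : ℝ} (h0 : 0 < t) (h1 : t < 1) : 0 < sin (π * t) :=
  sin_pos_of_pos_of_lt_pi (by positivity) (by nlinarith [pi_pos])

lemma log_two_mul_sin {t : ℝ} (h0 : 0 < t) (h1 : t < 1) :
    log (2 * sin (π * t)) = log 2 + log (sin (π * t)) :=
  log_mul two_ne_zero (sin_pi_mul_pos h0 h1).ne'

lemma logSinIntegral_zero : logSinIntegral 0 = 0 := by simp [logSinIntegral]

lemma logSinIntegral_eq_of_le_one {w : ℝ} (h0 : 0 ≤ w) (h1 : w ≤ 1) :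
    logSinIntegral w = w * log 2 + ∫ t in (0 : ℝ)..w, log (sin (π * t)) := by
  have h : logSinIntegral w = ∫ t in (0 : ℝ)..w, (log 2 + log (sin (π * t))) := by
    rw [logSinIntegral, intervalIntegral.integral_of_le h0, intervalIntegral.integral_of_le h0,
      integral_Ioc_eq_integral_Ioo, integral_Ioc_eq_integral_Ioo]
    exact setIntegral_congr_fun measurableSet_Ioo fun t ht =>
      log_two_mul_sin ht.1 (ht.2.trans_le h1)
  rw [h, intervalIntegral.integral_add (by simp) (intervalIntegrable_log_sin_pi_mul _ _)]
  simp

lemma log_two_add_meanLogSin {w : ℝ} (h0 : 0 < w) (h1 : w < 1) :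
    log 2 + meanLogSin w = logSinIntegral w / w := by
  rw [logSinIntegral_eq_of_le_one h0.le h1.le, meanLogSin]
  field_simp

lemma logSinIntegral_one : logSinIntegral 1 = 0 := by
  rw [logSinIntegral_eq_of_le_one zero_le_one le_rfl,
    intervalIntegral.integral_comp_mul_left (fun x => log (sin x)) pi_ne_zero]
  simp only [mul_zero, mul_one, integral_log_sin_zero_pi, smul_eq_mul]
  field_simp
  ring

lemma logSinIntegral_half : logSinIntegral (1 / 2) = 0 := by
  rw [logSinIntegral_eq_of_le_one (by norm_num) (by norm_num),
    intervalIntegral.integral_comp_mul_left (fun x => log (sin x)) pi_ne_zero,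
    show π * (1 / 2) = π / 2 by ring]
  simp only [mul_zero, integral_log_sin_zero_pi_div_two, smul_eq_mul]
  field_simp
  ring

lemma logSinIntegral_fract (s : ℝ) : logSinIntegral (Int.fract s) = logSinIntegral s := by
  have hper : Function.Periodic (fun t => log (2 * sin (π * t))) 1 := by
    intro t
    simp only
    rw [mul_add, mul_one, sin_add_pi, mul_neg, log_neg_eq_log]
  have h1 := hper.intervalIntegral_add_zsmul_eq ⌊s⌋ (Int.fract s)
    fun _ _ => intervalIntegrable_log_two_mul_sin _ _
  have h2 := logSinIntegral_one
  have h3 := hper.intervalIntegral_add_eq (Int.fract s) 0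
  rw [logSinIntegral] at h2
  simp only [zero_add] at h3
  rw [h3, h2, zsmul_zero, zsmul_eq_mul, mul_one, add_comm, Int.floor_add_fract] at h1
  have h4 := intervalIntegral.integral_add_adjacent_intervals
    (intervalIntegrable_log_two_mul_sin 0 (Int.fract s))
    (intervalIntegrable_log_two_mul_sin (Int.fract s) s)
  rw [h1, add_zero] at h4
  exact h4

lemma hasDerivAt_logSinIntegral {w : ℝ} (h0 : 0 < w) (h1 : w < 1) :
    HasDerivAt logSinIntegral (log (2 * sin (π * w))) w := by
  have hs := sin_pi_mul_pos h0 h1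
  refine intervalIntegral.integral_hasDerivAt_right (intervalIntegrable_log_two_mul_sin _ _) ?_ ?_
  · exact (Measurable.stronglyMeasurable (by fun_prop)).stronglyMeasurableAtFilter
  · exact ContinuousAt.log (by fun_prop) (by positivity)

lemma continuous_logSinIntegral : Continuous logSinIntegral :=
  intervalIntegral.continuous_primitive intervalIntegrable_log_two_mul_sin 0

/-- The numerator `w G'(w) - G(w)` of the derivative of `G(w) / w`, for `G = logSinIntegral`. -/
noncomputable def rateNumerator (w : ℝ) : ℝ := w * log (2 * sin (π * w)) - logSinIntegral w

lemma hasDerivAt_log_two_mul_sin {w : ℝ} (h0 : 0 < w) (h1 : w < 1) :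
    HasDerivAt (fun w => log (2 * sin (π * w))) (π * cot (π * w)) w := by
  have hs := sin_pi_mul_pos h0 h1
  have h : HasDerivAt (fun w => 2 * sin (π * w)) (2 * (cos (π * w) * (π * 1))) w :=
    (((hasDerivAt_id w).const_mul π).sin).const_mul 2
  convert h.log (by positivity) using 1
  rw [cot_eq_cos_div_sin]
  field_simp

lemma hasDerivAt_rateNumerator {w : ℝ} (h0 : 0 < w) (h1 : w < 1) :
    HasDerivAt rateNumerator (w * (π * cot (π * w))) w := by
  refine (((hasDerivAt_id w).fun_mul (hasDerivAt_log_two_mul_sin h0 h1)).fun_sub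
    (hasDerivAt_logSinIntegral h0 h1)).congr_deriv ?_
  simp

lemma hasDerivAt_logSinIntegral_div {w : ℝ} (h0 : 0 < w) (h1 : w < 1) :
    HasDerivAt (fun w => logSinIntegral w / w) (rateNumerator w / w ^ 2) w := by
  refine ((hasDerivAt_logSinIntegral h0 h1).fun_div (hasDerivAt_id w) h0.ne').congr_deriv ?_
  simp only [rateNumerator, id]
  ring

lemma cot_pi_mul_neg {w : ℝ} (h0 : 1 / 2 < w) (h1 : w < 1) : cot (π * w) < 0 := by
  rw [cot_eq_cos_div_sin]
  refine div_neg_of_neg_of_pos (cos_neg_of_pi_div_two_lt_of_lt ?_ ?_)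
    (sin_pi_mul_pos (by linarith) h1) <;> nlinarith [pi_pos]

lemma strictAntiOn_rateNumerator : StrictAntiOn rateNumerator (Ico (1 / 2) 1) := by
  refine strictAntiOn_of_deriv_neg (convex_Ico _ _) (fun w hw => ?_) fun w hw => ?_
  · exact (hasDerivAt_rateNumerator (by linarith [hw.1]) hw.2).continuousAt.continuousWithinAt
  · rw [interior_Ico] at hw
    rw [(hasDerivAt_rateNumerator (by linarith [hw.1]) hw.2).deriv]
    have := cot_pi_mul_neg hw.1 hw.2
    have hw0 : 0 < w := by linarith [hw.1]
    exact mul_neg_of_pos_of_neg hw0 (mul_neg_of_pos_of_neg pi_pos this)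

lemma one_half_lt_sin_pi_mul {t : ℝ} (h0 : 1 / 6 < t) (h1 : t < 5 / 6) :
    1 / 2 < sin (π * t) := by
  rw [← cos_sub_pi_div_two, ← cos_pi_div_three, ← cos_abs (π * t - π / 2)]
  refine cos_lt_cos_of_nonneg_of_le_pi (abs_nonneg _) (by linarith [pi_pos]) (abs_lt.2 ⟨?_, ?_⟩) <;>
    nlinarith [pi_pos]

lemma sin_pi_mul_lt_one_half {t : ℝ} (h0 : 0 < t) (h1 : t < 1 / 6) :
    sin (π * t) < 1 / 2 := by
  rw [← sin_pi_div_six]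
  exact sin_lt_sin_of_lt_of_le_pi_div_two (by nlinarith [pi_pos]) (by linarith [pi_pos])
    (by nlinarith [pi_pos])

lemma strictMonoOn_logSinIntegral : StrictMonoOn logSinIntegral (Icc (1 / 6) (5 / 6)) := by
  refine strictMonoOn_of_deriv_pos (convex_Icc _ _) continuous_logSinIntegral.continuousOn
    fun w hw => ?_
  rw [interior_Icc] at hw
  rw [(hasDerivAt_logSinIntegral (by linarith [hw.1]) (by linarith [hw.2])).deriv]
  exact log_pos (by linarith [one_half_lt_sin_pi_mul hw.1 hw.2])

lemma strictAntiOn_logSinIntegral : StrictAntiOn logSinIntegral (Icc 0 (1 / 6)) := by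
  refine strictAntiOn_of_deriv_neg (convex_Icc _ _) continuous_logSinIntegral.continuousOn
    fun w hw => ?_
  rw [interior_Icc] at hw
  rw [(hasDerivAt_logSinIntegral hw.1 (by linarith [hw.2])).deriv]
  have := sin_pi_mul_pos hw.1 (by linarith [hw.2])
  exact log_neg (by linarith) (by linarith [sin_pi_mul_lt_one_half hw.1 hw.2])

lemma logSinIntegral_nonpos {w : ℝ} (h0 : 0 ≤ w) (h1 : w ≤ 1 / 2) : logSinIntegral w ≤ 0 := by
  rcases le_total w (1 / 6) with h | h
  · rw [← logSinIntegral_zero]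
    exact strictAntiOn_logSinIntegral.antitoneOn ⟨le_rfl, by norm_num⟩ ⟨h0, h⟩ h0
  · rw [← logSinIntegral_half]
    exact strictMonoOn_logSinIntegral.monotoneOn ⟨h, by linarith⟩ ⟨by norm_num, by norm_num⟩ h1

/-- The maximum of `G(s) / s` over all `s > 0`, for `G = logSinIntegral`, is positive and attained
only at a point of `(1/2, 5/6)`. -/
theorem exists_rate_max : ∃ w₀ K : ℝ, 1 / 2 < w₀ ∧ w₀ < 5 / 6 ∧ 0 < K ∧
    K = log (2 * sin (π * w₀)) ∧ logSinIntegral w₀ = K * w₀ ∧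
    ∀ s, 0 < s → s ≠ w₀ → logSinIntegral s < K * s := by
  have hhalf : 0 < rateNumerator (1 / 2) := by
    rw [rateNumerator, logSinIntegral_half, mul_one_div, sin_pi_div_two]
    have := log_pos one_lt_two
    norm_num
    linarith
  have hfive : rateNumerator (5 / 6) < 0 := by
    have h1 : sin (π * (5 / 6)) = 1 / 2 := by
      rw [← sin_pi_div_six, ← sin_pi_sub]
      congr 1
      ring
    have h2 := strictMonoOn_logSinIntegral (a := 1 / 2) (b := 5 / 6) ⟨by norm_num, by norm_num⟩
      ⟨by norm_num, by norm_num⟩ (by norm_num)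
    rw [logSinIntegral_half] at h2
    rw [rateNumerator, h1]
    norm_num
    exact h2
  obtain ⟨w₀, hw, hz⟩ := intermediate_value_Ioo' (show (1 / 2 : ℝ) ≤ 5 / 6 by norm_num)
    (f := rateNumerator) (fun w hw => (hasDerivAt_rateNumerator (by linarith [hw.1])
      (by linarith [hw.2])).continuousAt.continuousWithinAt) ⟨hfive, hhalf⟩
  have hw0 : 0 < w₀ := by linarith [hw.1]
  have hw1 : w₀ < 1 := by linarith [hw.2]
  set K := log (2 * sin (π * w₀)) with hK
  have hKpos : 0 < K :=
    log_pos (by linarith [one_half_lt_sin_pi_mul (t := w₀) (by linarith [hw.1]) hw.2])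
  have hval : logSinIntegral w₀ = K * w₀ := by
    rw [rateNumerator, ← hK] at hz
    linarith
  have hmono : StrictMonoOn (fun w => logSinIntegral w / w) (Icc (1 / 2) w₀) := by
    refine strictMonoOn_of_deriv_pos (convex_Icc _ _) (fun w h => ?_) fun w h => ?_
    · exact (hasDerivAt_logSinIntegral_div (by linarith [h.1])
        (by linarith [h.2])).continuousAt.continuousWithinAt
    · rw [interior_Icc] at h
      have hwp : 0 < w := by linarith [h.1]
      rw [(hasDerivAt_logSinIntegral_div hwp (by linarith [h.2])).deriv]
      have := strictAntiOn_rateNumerator ⟨h.1.le, by linarith [h.2]⟩ ⟨hw.1.le, hw1⟩ h.2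
      rw [hz] at this
      positivity
  have hanti : StrictAntiOn (fun w => logSinIntegral w / w) (Ico w₀ 1) := by
    refine strictAntiOn_of_deriv_neg (convex_Ico _ _) (fun w h => ?_) fun w h => ?_
    · exact (hasDerivAt_logSinIntegral_div (by linarith [h.1])
        (by linarith [h.2])).continuousAt.continuousWithinAt
    · rw [interior_Ico] at h
      have hwp : 0 < w := by linarith [h.1]
      rw [(hasDerivAt_logSinIntegral_div hwp (by linarith [h.2])).deriv]
      have := strictAntiOn_rateNumerator ⟨hw.1.le, hw1⟩ ⟨by linarith [h.1, hw.1], h.2⟩ h.1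
      rw [hz] at this
      exact div_neg_of_neg_of_pos this (by positivity)
  have hvd : logSinIntegral w₀ / w₀ = K := by rw [hval]; field_simp
  have hlt : ∀ s, 0 < s → s < 1 → s ≠ w₀ → logSinIntegral s < K * s := by
    intro s h0 h1 hne
    rcases le_total s (1 / 2) with h | h
    · exact (logSinIntegral_nonpos h0.le h).trans_lt (by positivity)
    · rw [← div_lt_iff₀ h0, ← hvd]
      rcases lt_or_gt_of_ne hne with h' | h'
      · exact hmono ⟨h, h'.le⟩ ⟨hw.1.le, le_rfl⟩ h'
      · exact hanti ⟨le_rfl, hw1⟩ ⟨h'.le, h1⟩ h'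
  refine ⟨w₀, K, hw.1, hw.2, hKpos, rfl, hval, fun s hs hne => ?_⟩
  rcases lt_or_ge s 1 with h1 | h1
  · exact hlt s hs h1 hne
  · rw [← logSinIntegral_fract]
    have hf := Int.fract_lt_one s
    have hle : logSinIntegral (Int.fract s) ≤ K * Int.fract s := by
      rcases (Int.fract_nonneg s).eq_or_lt with h | h
      · rw [← h, logSinIntegral_zero, mul_zero]
      · by_cases hc : Int.fract s = w₀
        · rw [hc, hval]
        · exact (hlt _ h hf hc).le
    exact hle.trans_lt (mul_lt_mul_of_pos_left (by linarith) hKpos)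

/-- Second-order Taylor expansion of `G(w) / w` at its critical point. -/
theorem tendsto_rate_sub_div_sq {w₀ K : ℝ} (h0 : 1 / 2 < w₀) (h1 : w₀ < 1)
    (hK : K = log (2 * sin (π * w₀))) (hval : logSinIntegral w₀ = K * w₀) :
    Tendsto (fun w => (logSinIntegral w / w - K) / (w - w₀) ^ 2) (𝓝[≠] w₀)
      (𝓝 (π / w₀ * cot (π * w₀) / 2)) := by
  have hw0 : 0 < w₀ := by linarith
  have hnhds : ∀ᶠ w in 𝓝[≠] w₀, w ∈ Ioo 0 1 :=
    eventually_nhdsWithin_of_eventually_nhds (Ioo_mem_nhds hw0 h1)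
  have hz : rateNumerator w₀ = 0 := by rw [rateNumerator, ← hK, hval]; ring
  refine HasDerivAt.lhopital_zero_nhdsNE (f' := fun w => rateNumerator w / w ^ 2)
    (g' := fun w => 2 * (w - w₀)) ?_ ?_ ?_ ?_ ?_ ?_
  · filter_upwards [hnhds] with w hw
    exact (hasDerivAt_logSinIntegral_div hw.1 hw.2).sub_const K
  · refine Eventually.of_forall fun w => ?_
    simpa using ((hasDerivAt_id w).sub_const w₀).fun_pow 2
  · filter_upwards [self_mem_nhdsWithin] with w hw
    exact mul_ne_zero two_ne_zero (sub_ne_zero.2 hw)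
  · have := ((hasDerivAt_logSinIntegral_div hw0 h1).continuousAt.tendsto.sub_const K)
    rw [hval, mul_div_assoc, div_self hw0.ne', mul_one, sub_self] at this
    exact this.mono_left nhdsWithin_le_nhds
  · have : Tendsto (fun w => (w - w₀) ^ 2) (𝓝 w₀) (𝓝 ((w₀ - w₀) ^ 2)) :=
      Continuous.tendsto (by fun_prop) w₀
    rw [sub_self, zero_pow two_ne_zero] at this
    exact this.mono_left nhdsWithin_le_nhds
  · have hslope := hasDerivAt_iff_tendsto_slope.1 (hasDerivAt_rateNumerator hw0 h1)
    have hsq : Tendsto (fun w : ℝ => (2 * w ^ 2)⁻¹) (𝓝[≠] w₀) (𝓝 (2 * w₀ ^ 2)⁻¹) := by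
      refine Tendsto.mono_left ?_ nhdsWithin_le_nhds
      exact ContinuousAt.tendsto (ContinuousAt.inv₀ (by fun_prop) (by positivity))
    convert hslope.mul hsq using 2
    · rw [slope_def_field, hz, sub_zero]
      field_simp
    · field_simp

/-! ### Fourier modes and Riemann sums -/

/-- The mean of `Re z^k` over `1 ≤ k ≤ n`. -/
noncomputable def powerMean (n : ℕ) (z : ℂ) : ℝ :=
  (n : ℝ)⁻¹ * ∑ k ∈ Finset.range n, (z ^ (k + 1)).re

/-- The mean of `log |1 - r z^k|` over `1 ≤ k ≤ n`. -/
noncomputable def logMean (n : ℕ) (r : ℝ) (z : ℂ) : ℝ :=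
  (n : ℝ)⁻¹ * ∑ k ∈ Finset.range n, log ‖1 - r * z ^ (k + 1)‖

lemma norm_one_sub_le {z : ℂ} (hz : ‖z‖ = 1) {r : ℝ} (h0 : 0 ≤ r) :
    ‖1 - z‖ ≤ 2 / (1 + r) * ‖1 - r * z‖ := by
  have hsq : z.re * z.re + z.im * z.im = 1 := by
    rw [← Complex.normSq_apply, ← Complex.sq_norm, hz, one_pow]
  have hre : -1 ≤ z.re := by nlinarith [mul_self_nonneg z.im]
  rw [div_mul_eq_mul_div, le_div_iff₀ (by positivity)]
  refine abs_le_of_sq_le_sq' ?_ (by positivity) |>.2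
  rw [mul_pow, mul_pow, Complex.sq_norm, Complex.sq_norm, Complex.normSq_apply,
    Complex.normSq_apply]
  simp only [Complex.sub_re, Complex.one_re, Complex.sub_im, Complex.one_im, Complex.mul_re,
    Complex.mul_im, Complex.ofReal_re, Complex.ofReal_im, zero_mul, sub_zero, add_zero]
  -- The difference of the two sides is `2 (1 - r)² (1 + Re z)`.
  nlinarith [mul_nonneg (sq_nonneg (1 - r)) (by linarith : 0 ≤ 1 + z.re)]

lemma norm_one_sub_mul_pos {z : ℂ} (hz : ‖z‖ = 1) {r : ℝ} (h0 : 0 ≤ r) (h1 : r < 1) :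
    0 < ‖1 - r * z‖ := by
  have h := norm_sub_norm_le (1 : ℂ) (r * z)
  rw [norm_mul, hz, norm_one, Complex.norm_real, norm_of_nonneg h0] at h
  linarith

lemma norm_prod_le_exp_logMean {z : ℂ} (hz : ‖z‖ = 1) {r : ℝ} (h0 : 0 ≤ r) (h1 : r < 1) (n : ℕ) :
    ‖∏ k ∈ Finset.range n, (1 - z ^ (k + 1))‖ ≤ exp ((log (2 / (1 + r)) + logMean n r z) * n) := by
  rcases n.eq_zero_or_pos with rfl | hn
  · simp
  have hn' : (n : ℝ) ≠ 0 := by positivity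
  have he : (log (2 / (1 + r)) + logMean n r z) * n =
      ∑ k ∈ Finset.range n, (log (2 / (1 + r)) + log ‖1 - r * z ^ (k + 1)‖) := by
    rw [Finset.sum_add_distrib, logMean]
    simp only [Finset.sum_const, Finset.card_range, nsmul_eq_mul]
    field_simp
  rw [he, exp_sum, norm_prod]
  refine Finset.prod_le_prod (fun _ _ => norm_nonneg _) fun k _ => ?_
  have hzk : ‖z ^ (k + 1)‖ = 1 := by rw [norm_pow, hz, one_pow]
  rw [exp_add, exp_log (by positivity), exp_log (norm_one_sub_mul_pos hzk h0 h1)]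
  exact norm_one_sub_le hzk h0

lemma hasSum_neg_log_norm_one_sub {z : ℂ} (hz : ‖z‖ = 1) {r : ℝ} (h0 : 0 ≤ r) (h1 : r < 1) :
    HasSum (fun m : ℕ => r ^ m / m * (z ^ m).re) (-log ‖1 - r * z‖) := by
  have hlt : ‖(r : ℂ) * z‖ < 1 := by
    rwa [norm_mul, hz, mul_one, Complex.norm_real, norm_of_nonneg h0]
  have h := Complex.hasSum_re (Complex.hasSum_taylorSeries_neg_log hlt)
  rw [Complex.neg_re, Complex.log_re] at h
  convert h using 2 with m
  rw [mul_pow, mul_div_right_comm]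
  have : ((r : ℂ) ^ m / m) = ((r ^ m / m : ℝ) : ℂ) := by push_cast; rfl
  rw [this, Complex.re_ofReal_mul]

lemma hasSum_neg_logMean {z : ℂ} (hz : ‖z‖ = 1) {r : ℝ} (h0 : 0 ≤ r) (h1 : r < 1) (n : ℕ) :
    HasSum (fun m : ℕ => r ^ m / m * powerMean n (z ^ m)) (-logMean n r z) := by
  have h : HasSum (fun m : ℕ => (n : ℝ)⁻¹ * ∑ k ∈ Finset.range n,
      r ^ m / m * ((z ^ (k + 1)) ^ m).re)
      ((n : ℝ)⁻¹ * ∑ k ∈ Finset.range n, -log ‖1 - r * z ^ (k + 1)‖) :=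
    HasSum.mul_left _ (hasSum_sum fun k _ => hasSum_neg_log_norm_one_sub
      (by rw [norm_pow, hz, one_pow]) h0 h1)
  convert h using 2 with m
  · rw [powerMean, ← Finset.mul_sum, mul_left_comm]
    simp_rw [← pow_mul, mul_comm]
  · rw [logMean, Finset.sum_neg_distrib, mul_neg]

lemma abs_powerMean_le_one {z : ℂ} (hz : ‖z‖ = 1) (n : ℕ) : |powerMean n z| ≤ 1 := by
  rcases n.eq_zero_or_pos with rfl | hn
  · simp [powerMean]
  rw [powerMean, abs_mul, abs_of_nonneg (by positivity), inv_mul_le_iff₀ (by positivity), mul_one]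
  refine (Finset.abs_sum_le_sum_abs _ _).trans ?_
  refine (Finset.sum_le_card_nsmul _ _ 1 fun k _ => ?_).trans (by simp)
  refine (Complex.abs_re_le_norm _).trans ?_
  rw [norm_pow, hz, one_pow]

lemma abs_powerMean_le {z : ℂ} (hz : ‖z‖ = 1) (hz1 : z ≠ 1) (n : ℕ) :
    |powerMean n z| ≤ 2 / (n * ‖z - 1‖) := by
  rcases n.eq_zero_or_pos with rfl | hn
  · simp [powerMean]
  have hpos : 0 < ‖z - 1‖ := norm_pos_iff.2 (sub_ne_zero.2 hz1)
  have hgeom : ∑ k ∈ Finset.range n, (z ^ (k + 1)).re = (z * ((z ^ n - 1) / (z - 1))).re := by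
    rw [← geom_sum_eq hz1, Finset.mul_sum, Complex.re_sum]
    simp_rw [pow_succ']
  have hnum : ‖z ^ n - 1‖ ≤ 2 := by
    refine (norm_sub_le _ _).trans ?_
    rw [norm_pow, hz, one_pow, norm_one]
    norm_num
  rw [powerMean, hgeom, abs_mul, abs_of_nonneg (by positivity)]
  calc (n : ℝ)⁻¹ * |(z * ((z ^ n - 1) / (z - 1))).re|
      ≤ (n : ℝ)⁻¹ * ‖z * ((z ^ n - 1) / (z - 1))‖ := by gcongr; exact Complex.abs_re_le_norm _
    _ ≤ (n : ℝ)⁻¹ * (2 / ‖z - 1‖) := by rw [norm_mul, hz, one_mul, norm_div]; gcongr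
    _ = 2 / (n * ‖z - 1‖) := by field_simp

lemma tendsto_powerMean_zero {ι : Type*} {l : Filter ι} {n : ι → ℕ} {z : ι → ℂ}
    (hz : ∀ i, ‖z i‖ = 1) (h : Tendsto (fun i => n i * ‖z i - 1‖) l atTop) :
    Tendsto (fun i => powerMean (n i) (z i)) l (𝓝 0) := by
  refine squeeze_zero_norm' ?_ (h.const_div_atTop 2)
  filter_upwards [h.eventually_gt_atTop 0] with i hi
  refine abs_powerMean_le (hz i) (fun h1 => ?_) _
  rw [h1] at hi
  simp at hi

lemma norm_pow_div_mul_le {r x : ℝ} (h0 : 0 ≤ r) (hx : |x| ≤ 1) (m : ℕ) :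
    ‖r ^ m / m * x‖ ≤ r ^ m := by
  rw [norm_mul, norm_of_nonneg (by positivity)]
  rcases m.eq_zero_or_pos with rfl | hm
  · simp
  · have hm1 : (1 : ℝ) ≤ m := by exact_mod_cast hm
    calc r ^ m / m * ‖x‖ ≤ r ^ m / m * 1 := by gcongr; exact hx
      _ ≤ r ^ m := by rw [mul_one]; exact div_le_self (by positivity) hm1

lemma tendsto_logMean_zero {ι : Type*} {l : Filter ι} {n : ι → ℕ} {z : ι → ℂ}
    (hz : ∀ i, ‖z i‖ = 1) (h : ∀ m, 0 < m → Tendsto (fun i => powerMean (n i) (z i ^ m)) l (𝓝 0))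
    {r : ℝ} (h0 : 0 ≤ r) (h1 : r < 1) :
    Tendsto (fun i => logMean (n i) r (z i)) l (𝓝 0) := by
  have ht := tendsto_tsum_of_dominated_convergence (𝓕 := l)
    (f := fun i (m : ℕ) => r ^ m / m * powerMean (n i) (z i ^ m)) (g := fun _ => 0)
    (summable_geometric_of_lt_one h0 h1) (fun m => ?_) (Eventually.of_forall fun i m =>
      norm_pow_div_mul_le h0 (abs_powerMean_le_one (by rw [norm_pow, hz, one_pow]) _) m)
  · simp_rw [(hasSum_neg_logMean (hz _) h0 h1 _).tsum_eq, tsum_zero] at ht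
    simpa using ht.neg
  · rcases m.eq_zero_or_pos with rfl | hm
    · simpa using tendsto_const_nhds
    · simpa using (h m hm).const_mul (r ^ m / m)

/-- If only the Fourier modes divisible by `q` survive, then the mean of `log |1 - r z^k|` is
asymptotically `1/q` times the mean of `log |1 - r^q (z^q)^k|`. -/
lemma tendsto_logMean_sub_logMean_pow {ι : Type*} {l : Filter ι} {n : ι → ℕ} {z : ι → ℂ}
    (hz : ∀ i, ‖z i‖ = 1) {q : ℕ} (hq : 0 < q)
    (h : ∀ m, ¬ q ∣ m → Tendsto (fun i => powerMean (n i) (z i ^ m)) l (𝓝 0))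
    {r : ℝ} (h0 : 0 ≤ r) (h1 : r < 1) :
    Tendsto (fun i => logMean (n i) r (z i) - (q : ℝ)⁻¹ * logMean (n i) (r ^ q) (z i ^ q))
      l (𝓝 0) := by
  classical
  have hsum : ∀ i, HasSum (fun m : ℕ => if q ∣ m then 0 else r ^ m / m * powerMean (n i) (z i ^ m))
      (-(logMean (n i) r (z i) - (q : ℝ)⁻¹ * logMean (n i) (r ^ q) (z i ^ q))) := by
    intro i
    have ha := hasSum_neg_logMean (hz i) h0 h1 (n i)
    have hb := (hasSum_neg_logMean (z := z i ^ q) (by rw [norm_pow, hz, one_pow])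
      (pow_nonneg h0 q) (pow_lt_one₀ h0 h1 hq.ne') (n i)).mul_left (q : ℝ)⁻¹
    have hinj : Function.Injective fun j : ℕ => q * j := mul_right_injective₀ hq.ne'
    have hc : HasSum (fun m : ℕ => if q ∣ m then r ^ m / m * powerMean (n i) (z i ^ m) else 0)
        ((q : ℝ)⁻¹ * -logMean (n i) (r ^ q) (z i ^ q)) := by
      refine (hinj.hasSum_iff fun m hm => if_neg fun hd => hm ?_).1 ?_
      · obtain ⟨j, rfl⟩ := hd
        exact ⟨j, rfl⟩
      · convert! hb using 1
        funext j
        simp only [Function.comp_apply, dvd_mul_right, if_true, pow_mul]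
        push_cast
        have : (q : ℝ) ≠ 0 := by positivity
        rcases j.eq_zero_or_pos with rfl | hj
        · simp
        · field_simp
    convert! ha.sub hc using 1
    · funext m
      split_ifs <;> simp
    · ring
  have ht := tendsto_tsum_of_dominated_convergence (𝓕 := l)
    (f := fun i m => if q ∣ m then 0 else r ^ m / m * powerMean (n i) (z i ^ m)) (g := fun _ => 0)
    (summable_geometric_of_lt_one h0 h1) (fun m => ?_) (Eventually.of_forall fun i m => ?_)
  · simp_rw [(hsum _).tsum_eq, tsum_zero] at ht
    simpa using ht.neg
  · by_cases hm : q ∣ m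
    · simpa [hm] using tendsto_const_nhds
    · simpa [hm] using (h m hm).const_mul (r ^ m / m)
  · split_ifs
    · simpa using pow_nonneg h0 m
    · exact norm_pow_div_mul_le h0 (abs_powerMean_le_one (by rw [norm_pow, hz, one_pow]) _) m

/-- Riemann sums with `n` nodes of `x ↦ φ (t x)` converge to `∫_0^1 φ (s x) dx` as `n → ∞` and
`t → s`. -/
lemma tendsto_riemannSum {φ : ℝ → ℝ} (hφ : Continuous φ) (s : ℝ) :
    Tendsto (fun p : ℕ × ℝ =>
      (p.1 : ℝ)⁻¹ * ∑ k ∈ Finset.range p.1, φ (p.2 * ((k + 1 : ℕ) / p.1)))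
      (atTop ×ˢ 𝓝 s) (𝓝 (∫ x in (0 : ℝ)..1, φ (s * x))) := by
  rw [Metric.tendsto_nhds]
  intro ε hε
  have hu := (isCompact_Icc (a := -(|s| + 1)) (b := |s| + 1)).uniformContinuousOn_of_continuous
    hφ.continuousOn
  obtain ⟨δ, hδ, hcl⟩ := Metric.uniformContinuousOn_iff.1 hu (ε / 2) (by positivity)
  have h1 : ∀ᶠ n : ℕ in atTop, |s| / (n : ℝ) < δ / 2 :=
    (tendsto_const_div_atTop_nhds_zero_nat |s|).eventually (gt_mem_nhds (by positivity))
  have h2 : ∀ᶠ t in 𝓝 s, |t - s| < min (δ / 2) 1 :=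
    eventually_abs_sub_lt s (by positivity)
  filter_upwards [(h1.and (eventually_gt_atTop 0)).prod_mk h2] with ⟨n, t⟩ ⟨⟨hn, hn0⟩, ht⟩
  simp only at hn hn0 ht ⊢
  have hnp : (0 : ℝ) < n := by exact_mod_cast hn0
  have hint : ∀ a b : ℝ, IntervalIntegrable (fun x => φ (s * x)) volume a b := fun a b =>
    Continuous.intervalIntegrable (by fun_prop) a b
  have hsplit : ∫ x in (0 : ℝ)..1, φ (s * x) =
      ∑ k ∈ Finset.range n, ∫ x in ((k : ℕ) / n : ℝ)..((k + 1 : ℕ) / n : ℝ), φ (s * x) := by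
    rw [intervalIntegral.sum_integral_adjacent_intervals (a := fun k : ℕ => (k / n : ℝ))
      fun k _ => hint _ _]
    simp [hnp.ne']
  rw [dist_eq_norm, hsplit, Finset.mul_sum, ← Finset.sum_sub_distrib]
  have hterm : ∀ k ∈ Finset.range n, ‖(n : ℝ)⁻¹ * φ (t * ((k + 1 : ℕ) / n)) -
      ∫ x in ((k : ℕ) / n : ℝ)..((k + 1 : ℕ) / n : ℝ), φ (s * x)‖ ≤ ε / 2 * (n : ℝ)⁻¹ := by
    intro k hk
    have hlen : ((k + 1 : ℕ) / n : ℝ) - (k : ℕ) / n = (n : ℝ)⁻¹ := by push_cast; field_simp; ring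
    have hk1 : ((k + 1 : ℕ) / n : ℝ) ≤ 1 := by
      rw [div_le_one hnp]
      exact_mod_cast Finset.mem_range.1 hk
    have hc : (n : ℝ)⁻¹ * φ (t * ((k + 1 : ℕ) / n)) =
        ∫ _ in ((k : ℕ) / n : ℝ)..((k + 1 : ℕ) / n : ℝ), φ (t * ((k + 1 : ℕ) / n)) := by
      rw [intervalIntegral.integral_const, hlen, smul_eq_mul]
    rw [hc, ← intervalIntegral.integral_sub (by simp) (hint _ _)]
    have hinv : (0 : ℝ) < (n : ℝ)⁻¹ := by positivity
    refine (intervalIntegral.norm_integral_le_of_norm_le_const (C := ε / 2) fun x hx => ?_).trans ?_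
    · rw [uIoc_of_le (by linarith)] at hx
      have hx0 : 0 ≤ x := le_trans (by positivity) hx.1.le
      have hkp : (0 : ℝ) ≤ (k + 1 : ℕ) / n := by positivity
      have hts := lt_min_iff.1 ht
      have hdist : |t * ((k + 1 : ℕ) / n) - s * x| < δ := by
        have e : t * ((k + 1 : ℕ) / n) - s * x =
            (t - s) * ((k + 1 : ℕ) / n) + s * ((k + 1 : ℕ) / n - x) := by ring
        rw [e]
        refine (abs_add_le _ _).trans_lt ?_
        rw [abs_mul, abs_mul, abs_of_nonneg hkp, abs_of_nonneg (sub_nonneg.2 hx.2)]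
        have b1 : |t - s| * ((k + 1 : ℕ) / n) ≤ |t - s| * 1 := by gcongr
        have b2 : |s| * ((k + 1 : ℕ) / n - x) ≤ |s| * (n : ℝ)⁻¹ := by
          gcongr
          linarith [hx.1]
        rw [← div_eq_mul_inv] at b2
        linarith [hts.1]
      have hle : ∀ u y : ℝ, 0 ≤ y → y ≤ 1 → |u| ≤ |s| + 1 → u * y ∈ Icc (-(|s| + 1)) (|s| + 1) := by
        intro u y hy0 hy1 hu
        rw [mem_Icc, ← abs_le, abs_mul, abs_of_nonneg hy0]
        calc |u| * y ≤ |u| * 1 := by gcongr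
          _ ≤ |s| + 1 := by linarith
      have htb : |t| ≤ |s| + 1 := by
        have := abs_sub_abs_le_abs_sub t s
        linarith [hts.2]
      have := hcl _ (hle t _ hkp hk1 htb) _ (hle s x hx0 (hx.2.trans hk1) (by linarith)) hdist
      rw [dist_eq_norm] at this
      exact this.le
    · rw [hlen, abs_of_pos hinv]
  calc _ ≤ ∑ k ∈ Finset.range n, ε / 2 * (n : ℝ)⁻¹ := norm_sum_le_of_le _ hterm
    _ = ε / 2 := by
      simp only [Finset.sum_const, Finset.card_range, nsmul_eq_mul]
      field_simp
    _ < ε := by linarith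

/-! ### Exponential smallness away from the peak -/

lemma norm_one_sub_exp_mul_I (x : ℝ) :
    ‖1 - Complex.exp (x * Complex.I)‖ = |2 * sin (x / 2)| := by
  rw [← norm_neg, neg_sub, mul_comm, Complex.norm_exp_I_mul_ofReal_sub_one, norm_eq_abs]

lemma integral_log_two_mul_sin_mul {s : ℝ} (hs : s ≠ 0) :
    ∫ x in (0 : ℝ)..1, log (2 * sin (π * (s * x))) = logSinIntegral |s| / |s| := by
  have h1 : ∫ x in (0 : ℝ)..1, log (2 * sin (π * (|s| * x))) = logSinIntegral |s| / |s| := by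
    rw [intervalIntegral.integral_comp_mul_left (fun y => log (2 * sin (π * y)))
      (abs_ne_zero.2 hs), mul_zero, mul_one, ← logSinIntegral, smul_eq_mul, inv_mul_eq_div]
  rw [← h1]
  congr 1
  funext x
  rcases abs_choice s with h | h
  · rw [h]
  · rw [h, neg_mul, mul_neg, sin_neg, mul_neg, log_neg_eq_log]

/-- `∫_0^1 log |1 - r e^{2πisx}| dx` converges as `r → 1`, although the limiting integrand may have
logarithmic singularities. -/
lemma tendsto_integral_log_norm_one_sub {s : ℝ} (hs : s ≠ 0) :
    Tendsto (fun r : ℝ => ∫ x in (0 : ℝ)..1,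
        log ‖1 - r * Complex.exp ((2 * π * (s * x) : ℝ) * Complex.I)‖)
      (𝓝[<] 1) (𝓝 (logSinIntegral |s| / |s|)) := by
  rw [← integral_log_two_mul_sin_mul hs]
  have hsin : ∀ x : ℝ, ‖1 - Complex.exp ((2 * π * (s * x) : ℝ) * Complex.I)‖ =
      |2 * sin (π * (s * x))| := by
    intro x
    rw [norm_one_sub_exp_mul_I]
    congr 3
    ring
  have hint : IntervalIntegrable (fun x => log (2 * sin (π * (s * x)))) volume 0 1 := by
    have h : AnalyticOnNhd ℝ (fun t : ℝ => 2 * sin (π * (s * t))) univ := by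
      intro x _
      fun_prop
    exact (h.mono (subset_univ _)).meromorphicOn.intervalIntegrable_log
  have hne : ∀ᵐ x : ℝ, 2 * sin (π * (s * x)) ≠ 0 := by
    have hcount : (range fun k : ℤ => (k : ℝ) / s).Countable := countable_range _
    filter_upwards [hcount.ae_notMem volume] with x hx h0
    obtain ⟨k, hk⟩ := sin_eq_zero_iff.1 ((mul_eq_zero.1 h0).resolve_left two_ne_zero)
    refine hx ⟨k, ?_⟩
    rw [mul_comm] at hk
    have := mul_left_cancel₀ pi_ne_zero hk
    simp only [this]
    field_simp
  have hr : ∀ᶠ r : ℝ in 𝓝[<] 1, r ∈ Ico 0 1 := Ico_mem_nhdsLT one_pos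
  refine intervalIntegral.tendsto_integral_filter_of_dominated_convergence
    (fun x => log 2 + |log (2 * sin (π * (s * x)))|) ?_ ?_ ?_ ?_
  · refine Eventually.of_forall fun r => Measurable.aestronglyMeasurable ?_
    fun_prop
  · filter_upwards [hr] with r hr
    filter_upwards [hne] with x hx _
    set z := Complex.exp ((2 * π * (s * x) : ℝ) * Complex.I) with hzdef
    have hz : ‖z‖ = 1 := Complex.norm_exp_ofReal_mul_I _
    have hpos := norm_one_sub_mul_pos hz hr.1 hr.2
    have hup : ‖1 - r * z‖ ≤ 2 := by
      refine (norm_sub_le _ _).trans ?_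
      rw [norm_mul, hz, norm_one, Complex.norm_real, norm_of_nonneg hr.1]
      linarith [hr.2]
    have hlow : |2 * sin (π * (s * x))| ≤ 2 * ‖1 - r * z‖ := by
      rw [← hsin]
      refine (norm_one_sub_le hz hr.1).trans ?_
      gcongr
      exact div_le_self zero_le_two (by linarith [hr.1])
    have h1 := log_le_log hpos hup
    have h2 := log_le_log (abs_pos.2 hx) hlow
    rw [log_abs, log_mul two_ne_zero hpos.ne'] at h2
    rw [norm_eq_abs, abs_le]
    constructor
    · linarith [neg_abs_le (log (2 * sin (π * (s * x))))]
    · linarith [abs_nonneg (log (2 * sin (π * (s * x))))]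
  · exact intervalIntegrable_const.add hint.abs
  · filter_upwards [hne] with x hx _
    rw [← log_abs (2 * sin _), ← hsin]
    rw [← abs_pos, ← hsin] at hx
    refine Tendsto.log ?_ hx.ne'
    refine tendsto_nhdsWithin_of_tendsto_nhds ?_
    have hc : Continuous fun r : ℝ =>
        ‖1 - (r : ℂ) * Complex.exp ((2 * π * (s * x) : ℝ) * Complex.I)‖ := by fun_prop
    simpa using hc.tendsto 1

lemma integral_log_norm_one_sub_zero_nonpos {r : ℝ} (h0 : 0 ≤ r) (h1 : r ≤ 1) :
    ∫ x in (0 : ℝ)..1, log ‖1 - r * Complex.exp ((2 * π * (0 * x) : ℝ) * Complex.I)‖ ≤ 0 := by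
  have h : ‖(1 : ℂ) - r‖ = 1 - r := by
    rw [← Complex.ofReal_one, ← Complex.ofReal_sub, Complex.norm_real,
      norm_of_nonneg (by linarith)]
  simp only [zero_mul, mul_zero, Complex.ofReal_zero, Complex.exp_zero, mul_one, h,
    intervalIntegral.integral_const, smul_eq_mul, sub_zero, one_mul]
  exact log_nonpos (by linarith) (by linarith)

lemma tendsto_logMean_of_tendsto {ι : Type*} {l : Filter ι} {n : ι → ℕ} (hn : Tendsto n l atTop)
    {t : ι → ℝ} {s : ℝ} (ht : Tendsto t l (𝓝 s)) {z : ι → ℂ}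
    (hz : ∀ᶠ i in l, z i = Complex.exp ((2 * π * (t i / n i) : ℝ) * Complex.I))
    {r : ℝ} (h0 : 0 ≤ r) (h1 : r < 1) :
    Tendsto (fun i => logMean (n i) r (z i)) l (𝓝 (∫ x in (0 : ℝ)..1,
      log ‖1 - r * Complex.exp ((2 * π * (s * x) : ℝ) * Complex.I)‖)) := by
  have hφ : Continuous fun y : ℝ =>
      log ‖1 - r * Complex.exp ((2 * π * y : ℝ) * Complex.I)‖ := by
    refine Continuous.log (by fun_prop) fun y => ?_
    exact (norm_one_sub_mul_pos (Complex.norm_exp_ofReal_mul_I _) h0 h1).ne'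
  refine ((tendsto_riemannSum hφ s).comp (hn.prodMk ht)).congr' ?_
  filter_upwards [hz] with i hi
  simp only [Function.comp_apply, logMean]
  congr 1
  refine Finset.sum_congr rfl fun k _ => ?_
  rw [hi, ← Complex.exp_nat_mul]
  congr 5
  push_cast
  ring

lemma norm_pow_sub_one_le_mul {z : ℂ} (hz : ‖z‖ = 1) (j : ℕ) : ‖z ^ j - 1‖ ≤ j * ‖z - 1‖ := by
  induction j with
  | zero => simp
  | succ j ih =>
    have e : z ^ (j + 1) - 1 = z ^ j * (z - 1) + (z ^ j - 1) := by ring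
    rw [e]
    refine (norm_add_le _ _).trans ?_
    rw [norm_mul, norm_pow, hz, one_pow]
    push_cast
    linarith

/-- Along an ultrafilter, the product `∏_{k ≤ n} |1 - z^k|` has exponential growth rate below the
maximum `K`, unless `n arg z / 2π` approaches `±w₀`. Either all Fourier modes of the empirical
measure of `z, …, z^n` vanish in the limit, and the rate is `0`; or there is a least `q ≥ 1` for
which `n |z^q - 1|` stays bounded, only multiples of `q` survive, and the rate is at most
`G(s) / (q s)`, for `G = logSinIntegral` and `s = lim n |arg z^q| / 2π`. -/
theorem exists_rate_lt {ι : Type*} (𝒰 : Ultrafilter ι) {n : ι → ℕ} (hn : Tendsto n 𝒰 atTop)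
    {z : ι → ℂ} (hz : ∀ i, ‖z i‖ = 1) {w₀ K : ℝ} (hK : 0 < K)
    (hval : logSinIntegral w₀ = K * w₀)
    (hmax : ∀ s, 0 < s → s ≠ w₀ → logSinIntegral s < K * s) {ε : ℝ} (hε : 0 < ε)
    (hsep : ∀ i, ε ≤ |n i * |(z i).arg| / (2 * π) - w₀|) :
    ∃ c < K, ∀ᶠ i in 𝒰, ‖∏ k ∈ Finset.range (n i), (1 - z i ^ (k + 1))‖ ≤ exp (c * n i) := by
  have key : ∀ r : ℝ, 0 ≤ r → r < 1 → ∀ A, Tendsto (fun i => logMean (n i) r (z i)) 𝒰 (𝓝 A) →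
      log (2 / (1 + r)) + A < K →
      ∃ c < K, ∀ᶠ i in 𝒰, ‖∏ k ∈ Finset.range (n i), (1 - z i ^ (k + 1))‖ ≤ exp (c * n i) := by
    intro r h0 h1 A hA hlt
    obtain ⟨c, hc1, hc2⟩ := exists_between hlt
    refine ⟨c, hc2, ?_⟩
    filter_upwards [(hA.const_add (log (2 / (1 + r)))).eventually (gt_mem_nhds hc1)] with i hi
    refine (norm_prod_le_exp_logMean (hz i) h0 h1 (n i)).trans (exp_le_exp.2 ?_)
    gcongr
  have hlog : Tendsto (fun r : ℝ => log (2 / (1 + r))) (𝓝[<] 1) (𝓝 0) := by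
    have h : ContinuousAt (fun r : ℝ => log (2 / (1 + r))) 1 :=
      ContinuousAt.log (by fun_prop (disch := norm_num)) (by norm_num)
    have := h.tendsto
    norm_num at this
    exact this.mono_left nhdsWithin_le_nhds
  have hr01 : ∀ᶠ r : ℝ in 𝓝[<] 1, r ∈ Ico 0 1 := Ico_mem_nhdsLT one_pos
  by_cases hq : ∃ q, 0 < q ∧ ¬ Tendsto (fun i => n i * ‖z i ^ q - 1‖) 𝒰 atTop
  · classical
    obtain ⟨hqpos, hqb⟩ := Nat.find_spec hq
    have hqmin : ∀ t, 0 < t → t < Nat.find hq →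
        Tendsto (fun i => n i * ‖z i ^ t - 1‖) 𝒰 atTop := fun t ht htq => by
      have := Nat.find_min hq htq
      rw [not_and, not_not] at this
      exact this ht
    set q := Nat.find hq with hqdef
    obtain ⟨C, hC⟩ : ∃ C, ∀ᶠ i in 𝒰, n i * ‖z i ^ q - 1‖ < C := by
      simp only [tendsto_atTop, not_forall] at hqb
      obtain ⟨C, hC⟩ := hqb
      refine ⟨C, (Ultrafilter.eventually_not.2 hC).mono fun i hi => not_le.1 hi⟩
    have hzq : ∀ i, ‖z i ^ q‖ = 1 := fun i => by rw [norm_pow, hz, one_pow]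
    have hmodes : ∀ m, ¬ q ∣ m → Tendsto (fun i => powerMean (n i) (z i ^ m)) 𝒰 (𝓝 0) := by
      intro m hm
      refine tendsto_powerMean_zero (fun i => by rw [norm_pow, hz, one_pow]) ?_
      have ht := hqmin (m % q) (Nat.pos_of_ne_zero fun h => hm (Nat.dvd_of_mod_eq_zero h))
        (Nat.mod_lt _ hqpos)
      refine tendsto_atTop_mono' _ ?_ (tendsto_atTop_add_const_right _ (-((m / q : ℕ) * C)) ht)
      filter_upwards [hC] with i hi
      have h1 : ‖z i ^ (m % q) - 1‖ ≤ ‖z i ^ m - 1‖ + (m / q : ℕ) * ‖z i ^ q - 1‖ := by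
        have e : z i ^ m = (z i ^ q) ^ (m / q) * z i ^ (m % q) := by
          rw [← pow_mul, ← pow_add, Nat.div_add_mod]
        have e2 : z i ^ (m % q) - 1 = (z i ^ m - 1) -
            ((z i ^ q) ^ (m / q) - 1) * z i ^ (m % q) := by rw [e]; ring
        rw [e2]
        refine (norm_sub_le _ _).trans ?_
        rw [norm_mul, norm_pow (z i) (m % q), hz, one_pow, mul_one]
        gcongr
        exact norm_pow_sub_one_le_mul (hzq i) _
      have h2 : (n i : ℝ) * ‖z i ^ (m % q) - 1‖ ≤
          n i * ‖z i ^ m - 1‖ + (m / q : ℕ) * (n i * ‖z i ^ q - 1‖) := by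
        calc _ ≤ (n i : ℝ) * (‖z i ^ m - 1‖ + (m / q : ℕ) * ‖z i ^ q - 1‖) := by gcongr
          _ = _ := by ring
      have h3 : ((m / q : ℕ) : ℝ) * (n i * ‖z i ^ q - 1‖) ≤ (m / q : ℕ) * C := by gcongr
      linarith
    set t : ι → ℝ := fun i => n i * (z i ^ q).arg / (2 * π) with ht
    have htb : ∀ᶠ i in 𝒰, t i ∈ Icc (-(C / 4)) (C / 4) := by
      filter_upwards [hC] with i hi
      have h1 := Complex.angle_le_mul_norm_sub (hzq i) norm_one
      rw [Complex.angle_one_right (norm_ne_zero_iff.1 (by rw [hzq]; exact one_ne_zero))] at h1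
      rw [mem_Icc, ← abs_le, ht]
      simp only
      rw [abs_div, abs_mul, Nat.abs_cast, abs_of_pos two_pi_pos, div_le_iff₀ two_pi_pos]
      calc (n i : ℝ) * |(z i ^ q).arg| ≤ n i * (π / 2 * ‖z i ^ q - 1‖) := by gcongr
        _ = π / 2 * (n i * ‖z i ^ q - 1‖) := by ring
        _ ≤ π / 2 * C := by gcongr
        _ = C / 4 * (2 * π) := by ring
    obtain ⟨s, -, hs⟩ := (isCompact_Icc (a := -(C / 4)) (b := C / 4)).ultrafilter_le_nhds'
      (𝒰.map t) htb
    replace hs : Tendsto t 𝒰 (𝓝 s) := hs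
    have hexp : ∀ᶠ i in 𝒰, z i ^ q = Complex.exp ((2 * π * (t i / n i) : ℝ) * Complex.I) := by
      filter_upwards [hn.eventually (eventually_gt_atTop 0)] with i hi
      have hi' : (n i : ℝ) ≠ 0 := by positivity
      have e : 2 * π * (t i / n i) = (z i ^ q).arg := by
        rw [ht]
        have := pi_ne_zero
        field_simp
      have h := Complex.norm_mul_exp_arg_mul_I (z i ^ q)
      rw [hzq, Complex.ofReal_one, one_mul] at h
      rw [e, h]
    have hlim : ∀ r : ℝ, r ∈ Ico 0 1 → Tendsto (fun i => logMean (n i) r (z i)) 𝒰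
        (𝓝 ((q : ℝ)⁻¹ * ∫ x in (0 : ℝ)..1,
          log ‖1 - (r ^ q : ℝ) * Complex.exp ((2 * π * (s * x) : ℝ) * Complex.I)‖)) := by
      intro r hr
      have h1 := tendsto_logMean_sub_logMean_pow hz hqpos hmodes hr.1 hr.2
      have h2 := (tendsto_logMean_of_tendsto hn hs hexp (pow_nonneg hr.1 q)
        (pow_lt_one₀ hr.1 hr.2 hqpos.ne')).const_mul (q : ℝ)⁻¹
      simpa using h1.add h2
    have hqinv : (0 : ℝ) < (q : ℝ)⁻¹ := by positivity
    by_cases hs0 : s = 0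
    · obtain ⟨r, hr1, hr2⟩ := (hr01.and (hlog.eventually (gt_mem_nhds hK))).exists
      refine key r hr1.1 hr1.2 _ (hlim r hr1) ?_
      have := integral_log_norm_one_sub_zero_nonpos (pow_nonneg hr1.1 q)
        (pow_le_one₀ hr1.1 hr1.2.le)
      rw [hs0]
      nlinarith
    · have hsp : 0 < |s| := abs_pos.2 hs0
      have hle : logSinIntegral |s| / |s| ≤ K := by
        rw [div_le_iff₀ hsp]
        by_cases h : |s| = w₀
        · rw [h, hval]
        · exact (hmax _ hsp h).le
      have hlt : (q : ℝ)⁻¹ * (logSinIntegral |s| / |s|) < K := by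
        rcases Nat.lt_or_ge 1 q with h | h
        · have hq1 : (q : ℝ)⁻¹ < 1 := inv_lt_one_of_one_lt₀ (by exact_mod_cast h)
          nlinarith
        · have hq1 : q = 1 := by omega
          rw [hq1, Nat.cast_one, inv_one, one_mul, div_lt_iff₀ hsp]
          refine hmax _ hsp fun h => ?_
          have h1 : Tendsto (fun i => |(|t i| - w₀)|) 𝒰 (𝓝 |(|s| - w₀)|) :=
            (hs.abs.sub_const w₀).abs
          have h2 := ge_of_tendsto h1 (b := ε) (Eventually.of_forall fun i => ?_)
          · rw [h, sub_self, abs_zero] at h2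
            linarith
          · have := hsep i
            rw [ht]
            simp only
            rwa [abs_div, abs_mul, Nat.abs_cast, abs_of_pos two_pi_pos, hq1, pow_one]
      have hpow : Tendsto (fun r : ℝ => r ^ q) (𝓝[<] 1) (𝓝[<] 1) := by
        refine tendsto_nhdsWithin_iff.2 ⟨?_, ?_⟩
        · have : Tendsto (fun r : ℝ => r ^ q) (𝓝 1) (𝓝 (1 ^ q)) := (continuous_pow q).tendsto 1
          rw [one_pow] at this
          exact this.mono_left nhdsWithin_le_nhds
        · filter_upwards [hr01] with r hr
          exact pow_lt_one₀ hr.1 hr.2 hqpos.ne'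
      have htot := hlog.add
        (((tendsto_integral_log_norm_one_sub hs0).comp hpow).const_mul (q : ℝ)⁻¹)
      rw [zero_add] at htot
      obtain ⟨r, hr1, hr2⟩ := (hr01.and (htot.eventually (gt_mem_nhds hlt))).exists
      exact key r hr1.1 hr1.2 _ (hlim r hr1) hr2
  · push Not at hq
    obtain ⟨r, hr1, hr2⟩ := (hr01.and (hlog.eventually (gt_mem_nhds hK))).exists
    refine key r hr1.1 hr1.2 0 ?_ (by simpa using hr2)
    exact tendsto_logMean_zero hz (fun m hm => tendsto_powerMean_zero
      (fun i => by rw [norm_pow, hz, one_pow]) (hq m hm)) hr1.1 hr1.2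

/-- Away from `n |arg z| / 2π = w₀` the product is exponentially smaller than `e^{Kn}`, uniformly
in `z`. -/
theorem exists_uniform_bound {w₀ K : ℝ} (hK : 0 < K)
    (hval : logSinIntegral w₀ = K * w₀)
    (hmax : ∀ s, 0 < s → s ≠ w₀ → logSinIntegral s < K * s) {ε : ℝ} (hε : 0 < ε) :
    ∃ δ > 0, ∃ N : ℕ, ∀ n ≥ N, ∀ z : ℂ, ‖z‖ = 1 → ε ≤ |n * |z.arg| / (2 * π) - w₀| →
      ‖∏ k ∈ Finset.range n, (1 - z ^ (k + 1))‖ ≤ exp ((K - δ) * n) := by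
  by_contra! hcon
  choose n hn z hz hsep hlt using fun N : ℕ => hcon (1 / ((N : ℝ) + 1)) (by positivity) N
  have hU : ((hyperfilter ℕ : Ultrafilter ℕ) : Filter ℕ) ≤ atTop := Nat.hyperfilter_le_atTop
  have hntop : Tendsto n atTop atTop := tendsto_atTop_mono hn tendsto_id
  obtain ⟨c, hcK, hc⟩ := exists_rate_lt (hyperfilter ℕ) (hntop.mono_left hU) hz hK hval hmax
    hε hsep
  have hlim : Tendsto (fun N : ℕ => K - 1 / ((N : ℝ) + 1)) (hyperfilter ℕ) (𝓝 K) := by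
    simpa using (tendsto_one_div_add_atTop_nhds_zero_nat.mono_left hU).const_sub K
  refine hcK.not_ge (le_of_tendsto hlim ?_)
  filter_upwards [hc, (hntop.mono_left hU).eventually (eventually_gt_atTop 0)] with N h1 h2
  have h3 := exp_lt_exp.1 ((hlt N).trans_le h1)
  have h4 : (0 : ℝ) < n N := by exact_mod_cast h2
  exact (lt_of_mul_lt_mul_right h3 h4.le).le

/-! ### Uniform asymptotics on the scale `1/n` -/

lemma analyticAt_sinc (x : ℝ) : AnalyticAt ℝ sinc x := by
  rcases eq_or_ne x 0 with rfl | hx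
  · rw [sinc_eq_dslope]
    obtain ⟨p, hp⟩ := (by fun_prop : AnalyticAt ℝ sin 0)
    exact ⟨_, hp.has_fpower_series_dslope_fslope⟩
  · refine AnalyticAt.congr (f := fun y => sin y / y) (by fun_prop (disch := exact hx)) ?_
    filter_upwards [isOpen_ne.mem_nhds hx] with y hy
    exact (sinc_of_ne_zero hy).symm

lemma sinc_pi_mul_pos {t : ℝ} (h0 : -1 < t) (h1 : t < 1) : 0 < sinc (π * t) := by
  rcases lt_trichotomy t 0 with h | rfl | h
  · rw [← sinc_neg, ← mul_neg, sinc_of_ne_zero (by nlinarith [pi_pos])]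
    exact div_pos (sin_pi_mul_pos (by linarith) (by linarith)) (by nlinarith [pi_pos])
  · simp
  · rw [sinc_of_ne_zero (by positivity)]
    exact div_pos (sin_pi_mul_pos h h1) (by positivity)

/-- The regular part `log (sin πt / πt)` of `log (sin πt)` at `0`. -/
noncomputable def logSinc (t : ℝ) : ℝ := log (sinc (π * t))

lemma contDiffAt_logSinc {t : ℝ} (h0 : -1 < t) (h1 : t < 1) : ContDiffAt ℝ 2 logSinc t := by
  refine ContDiffAt.log ?_ (sinc_pi_mul_pos h0 h1).ne'
  exact (analyticAt_sinc (π * t)).contDiffAt.comp t (by fun_prop)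

lemma log_two_mul_sin_eq_add_logSinc {t : ℝ} (h0 : 0 < t) (h1 : t < 1) :
    log (2 * sin (π * t)) = log (2 * π) + log t + logSinc t := by
  have hs := sin_pi_mul_pos h0 h1
  rw [logSinc, sinc_of_ne_zero (by positivity), ← log_mul (by positivity) h0.ne',
    ← log_mul (by positivity) (by positivity)]
  congr 1
  field_simp

lemma intervalIntegrable_logSinc {w : ℝ} (h0 : 0 ≤ w) (h1 : w < 1) :
    IntervalIntegrable logSinc volume 0 w := by
  refine ContinuousOn.intervalIntegrable fun t ht => ?_
  rw [uIcc_of_le h0] at ht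
  exact (contDiffAt_logSinc (by linarith [ht.1]) (by linarith [ht.2])).continuousAt
    |>.continuousWithinAt

lemma logSinIntegral_eq_add_integral_logSinc {w : ℝ} (h0 : 0 < w) (h1 : w < 1) :
    logSinIntegral w = w * log (2 * π * w) - w + ∫ t in (0 : ℝ)..w, logSinc t := by
  have h : logSinIntegral w = ∫ t in (0 : ℝ)..w, (log (2 * π) + log t + logSinc t) := by
    rw [logSinIntegral, intervalIntegral.integral_of_le h0.le,
      intervalIntegral.integral_of_le h0.le]
    exact setIntegral_congr_fun measurableSet_Ioc fun t ht =>
      log_two_mul_sin_eq_add_logSinc ht.1 (ht.2.trans_lt h1)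
  have hlog : IntervalIntegrable (fun t => log t) volume 0 w :=
    intervalIntegral.intervalIntegrable_log'
  rw [h, intervalIntegral.integral_add (by simp)
      (intervalIntegrable_logSinc h0.le h1),
    intervalIntegral.integral_add (by simp) hlog, integral_log, log_mul (by positivity) h0.ne']
  simp
  ring

/-- Trapezoidal rule for `logSinc` on `[0, w]`, with error `O(1/n)` uniformly in `0 < w ≤ b < 1`. -/
lemma exists_sum_logSinc_bound {b : ℝ} (h0 : 0 < b) (h1 : b < 1) :
    ∃ M : ℝ, ∀ n : ℕ, 0 < n → ∀ w ∈ Ioc 0 b,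
      |∑ k ∈ Finset.range n, logSinc (w * ((k + 1 : ℕ) / n)) -
        (n * (∫ t in (0 : ℝ)..w, logSinc t) / w + logSinc w / 2)| ≤ M / n := by
  have hcd : ContDiffOn ℝ 2 logSinc (Icc 0 b) := fun t ht =>
    (contDiffAt_logSinc (by linarith [ht.1]) (by linarith [ht.2])).contDiffWithinAt
  obtain ⟨M, hM⟩ := isCompact_Icc.exists_bound_of_continuousOn
    (hcd.continuousOn_iteratedDerivWithin (m := 2) le_rfl (uniqueDiffOn_Icc h0))
  have hM0 : 0 ≤ M := (norm_nonneg _).trans (hM 0 ⟨le_rfl, h0.le⟩)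
  refine ⟨M, fun n hn w hw => ?_⟩
  have hnp : (0 : ℝ) < n := by exact_mod_cast hn
  have hwp : 0 < w := hw.1
  have hw1 : w < 1 := hw.2.trans_lt h1
  have htrap := trapezoidal_error_le_of_c2 (f := logSinc) (a := 0) (b := w) (ζ := M) (N := n)
    (by
      rw [uIcc_of_le hwp.le]
      exact hcd.mono (Icc_subset_Icc_right hw.2))
    (fun x => by
      rw [uIcc_of_le hwp.le]
      by_cases hx : x ∈ Icc 0 w
      · have hcx : ContDiffAt ℝ (2 : ℕ) logSinc x := by
          exact_mod_cast contDiffAt_logSinc (by linarith [hx.1]) (by linarith [hx.2])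
        have hxb : x ∈ Icc 0 b := ⟨hx.1, hx.2.trans hw.2⟩
        rw [iteratedDerivWithin_eq_iteratedDeriv (uniqueDiffOn_Icc hwp) hcx hx,
          ← iteratedDerivWithin_eq_iteratedDeriv (uniqueDiffOn_Icc h0) hcx hxb]
        exact hM x hxb
      · rw [iteratedDerivWithin_succ, derivWithin_zero_of_notMem_closure (by rwa [closure_Icc]),
          abs_zero]
        exact hM0) hn
  have hg0 : logSinc 0 = 0 := by simp [logSinc]
  have hsum : ∑ k ∈ Finset.range n, logSinc (w * ((k + 1 : ℕ) / n)) -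
      (n * (∫ t in (0 : ℝ)..w, logSinc t) / w + logSinc w / 2) =
      n / w * trapezoidal_error logSinc n 0 w := by
    obtain ⟨m, rfl⟩ := Nat.exists_eq_succ_of_ne_zero hn.ne'
    rw [trapezoidal_error, trapezoidal_integral, Finset.sum_range_succ, hg0]
    have e : ∀ k : ℕ, (0 : ℝ) + (k + 1) * (w - 0) / (m.succ : ℕ) =
        w * ((k + 1 : ℕ) / (m.succ : ℕ)) := fun k => by push_cast; ring
    simp only [e, Nat.succ_sub_one]
    rw [div_self hnp.ne', mul_one]
    field_simp
    ring
  rw [hsum, abs_mul, abs_of_pos (by positivity)]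
  rw [sub_zero, abs_of_pos hwp] at htrap
  calc n / w * |trapezoidal_error logSinc n 0 w| ≤ n / w * (w ^ 3 * M / (12 * n ^ 2)) := by gcongr
    _ = w ^ 2 * (M / n) / 12 := by field_simp
    _ ≤ 1 * (M / n) / 1 := by
      gcongr
      · nlinarith
      · norm_num
    _ = M / n := by ring

lemma tendsto_log_factorial_sub :
    Tendsto (fun n : ℕ => log (n.factorial) - (n * log n - n + log (2 * π * n) / 2))
      atTop (𝓝 0) := by
  have h := Stirling.factorial_isEquivalent_stirling
  have h1 := (isEquivalent_iff_tendsto_one ?_).1 h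
  · have h2 := h1.log one_ne_zero
    rw [log_one] at h2
    refine h2.congr' ?_
    filter_upwards [eventually_gt_atTop 0] with n hn
    have hnp : (0 : ℝ) < n := by exact_mod_cast hn
    have hf : (0 : ℝ) < n.factorial := by exact_mod_cast n.factorial_pos
    rw [Pi.div_apply, log_div hf.ne' (by positivity), log_mul (by positivity) (by positivity),
      log_sqrt (by positivity), log_pow, log_div hnp.ne' (exp_pos 1).ne', log_exp]
    ring_nf
  · filter_upwards [eventually_gt_atTop 0] with n hn
    have hnp : (0 : ℝ) < n := by exact_mod_cast hn
    positivity

/-- On the scale `θ = 2πw/n` the product is `e^{nG(w)/w} (2n sin(πw)/w)^{1/2} (1 + o(1))`, for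
`G = logSinIntegral`, uniformly in `0 < w ≤ b < 1`. Stirling's formula accounts for the logarithmic
singularity at `0`, and the trapezoidal rule for the rest. -/
theorem exists_log_prod_bound {b : ℝ} (h0 : 0 < b) (h1 : b < 1) :
    ∃ η : ℕ → ℝ, Tendsto η atTop (𝓝 0) ∧ ∀ n : ℕ, 0 < n → ∀ w ∈ Ioc 0 b,
      |log (∏ k ∈ Finset.range n, (2 * sin (π * (w * ((k + 1 : ℕ) / n))))) -
        (n * (logSinIntegral w / w) + log (2 * n * (sin (π * w) / w)) / 2)| ≤ η n := by
  obtain ⟨M, hM⟩ := exists_sum_logSinc_bound h0 h1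
  refine ⟨fun n => |log (n.factorial) - (n * log n - n + log (2 * π * n) / 2)| + M / n, ?_,
    fun n hn w hw => ?_⟩
  · simpa using tendsto_log_factorial_sub.abs.add (tendsto_const_div_atTop_nhds_zero_nat M)
  · have hnp : (0 : ℝ) < n := by exact_mod_cast hn
    have hwp : 0 < w := hw.1
    have hw1 : w < 1 := hw.2.trans_lt h1
    have hs := sin_pi_mul_pos hwp hw1
    have hnode : ∀ k ∈ Finset.range n, 0 < w * ((k + 1 : ℕ) / n) ∧ w * ((k + 1 : ℕ) / n) < 1 := by
      intro k hk
      refine ⟨by positivity, ?_⟩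
      have : ((k + 1 : ℕ) / n : ℝ) ≤ 1 := by
        rw [div_le_one hnp]
        exact_mod_cast Finset.mem_range.1 hk
      calc w * ((k + 1 : ℕ) / n) ≤ w * 1 := by gcongr
        _ < 1 := by linarith
    have hlog : log (∏ k ∈ Finset.range n, (2 * sin (π * (w * ((k + 1 : ℕ) / n))))) =
        n * (log (2 * π) + log w - log n) + log (n.factorial) +
          ∑ k ∈ Finset.range n, logSinc (w * ((k + 1 : ℕ) / n)) := by
      rw [log_prod fun k hk =>
        (mul_pos two_pos (sin_pi_mul_pos (hnode k hk).1 (hnode k hk).2)).ne']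
      rw [← Finset.prod_range_add_one_eq_factorial, Nat.cast_prod, log_prod fun k _ => by positivity]
      have hc : (n : ℝ) * (log (2 * π) + log w - log n) =
          ∑ _k ∈ Finset.range n, (log (2 * π) + log w - log n) := by
        rw [Finset.sum_const, Finset.card_range, nsmul_eq_mul]
      rw [hc, ← Finset.sum_add_distrib, ← Finset.sum_add_distrib]
      refine Finset.sum_congr rfl fun k hk => ?_
      rw [log_two_mul_sin_eq_add_logSinc (hnode k hk).1 (hnode k hk).2,
        log_mul hwp.ne' (by positivity), log_div (by positivity) hnp.ne']
      ring
    have hw2 : log (2 * n * (sin (π * w) / w)) = log (2 * π * n) + logSinc w := by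
      rw [logSinc, sinc_of_ne_zero (by positivity), ← log_mul (by positivity) (by positivity)]
      congr 1
      field_simp
    rw [hlog, hw2, logSinIntegral_eq_add_integral_logSinc hwp hw1,
      log_mul (x := 2 * π) (y := w) (by positivity) hwp.ne']
    refine (le_of_eq ?_).trans ((abs_add_le _ _).trans (add_le_add_right (hM n hn w hw) _))
    congr 1
    field_simp
    ring

/-! ### The rescaled product and the supremum norm -/

lemma norm_sudlerProduct (n : ℕ) (θ : ℝ) : ‖sudlerProduct n θ‖ =
    ‖∏ k ∈ Finset.range n, (1 - Complex.exp (θ * Complex.I) ^ (k + 1))‖ := by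
  rw [sudlerProduct, ← Finset.Ico_add_one_right_eq_Icc, Finset.prod_Ico_eq_prod_range]
  congr 1
  refine Finset.prod_congr rfl fun k _ => ?_
  rw [← Complex.exp_nat_mul]
  congr 2
  push_cast
  ring

lemma norm_sudlerProduct_eq_prod_sin (n : ℕ) (θ : ℝ) : ‖sudlerProduct n θ‖ =
    ∏ k ∈ Finset.range n, |2 * sin ((k + 1 : ℕ) * θ / 2)| := by
  rw [norm_sudlerProduct, norm_prod]
  refine Finset.prod_congr rfl fun k _ => ?_
  rw [← norm_one_sub_exp_mul_I, ← Complex.exp_nat_mul]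
  congr 3
  push_cast
  ring

lemma norm_sudlerProduct_neg (n : ℕ) (θ : ℝ) :
    ‖sudlerProduct n (-θ)‖ = ‖sudlerProduct n θ‖ := by
  simp only [norm_sudlerProduct_eq_prod_sin]
  refine Finset.prod_congr rfl fun k _ => ?_
  rw [mul_neg, neg_div, sin_neg, mul_neg, abs_neg]

lemma norm_sudlerProduct_abs (n : ℕ) (θ : ℝ) :
    ‖sudlerProduct n |θ|‖ = ‖sudlerProduct n θ‖ := by
  rcases abs_choice θ with h | h <;> rw [h]
  exact norm_sudlerProduct_neg n θ

lemma periodic_norm_sudlerProduct (n : ℕ) :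
    Function.Periodic (fun θ : ℝ => ‖sudlerProduct n θ‖) (2 * π) := by
  intro θ
  simp only [norm_sudlerProduct]
  congr 3
  funext k
  congr 2
  push_cast
  rw [add_mul, Complex.exp_periodic]

lemma continuous_norm_sudlerProduct (n : ℕ) : Continuous fun θ : ℝ => ‖sudlerProduct n θ‖ := by
  unfold sudlerProduct
  fun_prop

/-- The product at `θ = 2πw/n`, divided by `e^{Kn} n^{1/2}`. -/
noncomputable def rescaled (K : ℝ) (n : ℕ) (w : ℝ) : ℝ :=
  ‖sudlerProduct n (2 * π * w / n)‖ / (exp (K * n) * √n)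

lemma rescaled_nonneg (K : ℝ) (n : ℕ) (w : ℝ) : 0 ≤ rescaled K n w := by
  unfold rescaled
  positivity

lemma continuous_rescaled (K : ℝ) (n : ℕ) : Continuous (rescaled K n) := by
  unfold rescaled
  exact ((continuous_norm_sudlerProduct n).comp (by fun_prop)).div_const _

lemma norm_sudlerProduct_eq_rescaled (K : ℝ) {n : ℕ} (hn : 0 < n) (w : ℝ) :
    ‖sudlerProduct n (2 * π * w / n)‖ = exp (K * n) * √n * rescaled K n w := by
  have : 0 < exp (K * n) * √n := by positivity
  rw [rescaled]
  field_simp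

/-- The exponent and the amplitude of the rescaled product near `w₀`, with a multiplicative error
`e^{±η}` that is uniform in `w`. -/
lemma exists_rescaled_eq (K : ℝ) {b : ℝ} (h0 : 0 < b) (h1 : b < 1) :
    ∃ η : ℕ → ℝ, Tendsto η atTop (𝓝 0) ∧ ∀ n : ℕ, 0 < n → ∀ w ∈ Ioc 0 b, ∃ e, |e| ≤ η n ∧
      rescaled K n w =
        exp (n * (logSinIntegral w / w - K)) * √(2 * (sin (π * w) / w)) * exp e := by
  obtain ⟨η, hη, hb⟩ := exists_log_prod_bound h0 h1
  refine ⟨η, hη, fun n hn w hw => ⟨_, hb n hn w hw, ?_⟩⟩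
  have hnp : (0 : ℝ) < n := by exact_mod_cast hn
  have hwp : 0 < w := hw.1
  have hw1 : w < 1 := hw.2.trans_lt h1
  have hs := sin_pi_mul_pos hwp hw1
  have hpos : ∀ k ∈ Finset.range n, 0 < 2 * sin (π * (w * ((k + 1 : ℕ) / n))) := by
    intro k hk
    have : ((k + 1 : ℕ) / n : ℝ) ≤ 1 := by
      rw [div_le_one hnp]
      exact_mod_cast Finset.mem_range.1 hk
    refine mul_pos two_pos (sin_pi_mul_pos (by positivity) ?_)
    calc w * ((k + 1 : ℕ) / n) ≤ w * 1 := by gcongr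
      _ < 1 := by linarith
  have hprod : ‖sudlerProduct n (2 * π * w / n)‖ =
      ∏ k ∈ Finset.range n, (2 * sin (π * (w * ((k + 1 : ℕ) / n)))) := by
    rw [norm_sudlerProduct_eq_prod_sin]
    refine Finset.prod_congr rfl fun k hk => ?_
    rw [← abs_of_pos (hpos k hk)]
    congr 3
    ring
  have hsqrt : √(2 * n * (sin (π * w) / w)) = √n * √(2 * (sin (π * w) / w)) := by
    rw [← sqrt_mul hnp.le]
    congr 1
    ring
  have hhalf : exp (log (2 * n * (sin (π * w) / w)) / 2) = √n * √(2 * (sin (π * w) / w)) := by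
    rw [← hsqrt, ← log_sqrt (by positivity), exp_log (by positivity)]
  rw [rescaled, hprod, div_eq_iff (by positivity), exp_sub _ (_ + _),
    exp_log (Finset.prod_pos hpos), exp_add, hhalf, mul_sub, exp_sub, mul_comm K]
  field_simp

variable {w₀ K κ : ℝ}

/-- Under the substitution `w = w₀ + u / √n` the exponent converges to `-κ u²`. -/
lemma tendsto_mul_rate_sub
    (htaylor : Tendsto (fun w => (logSinIntegral w / w - K) / (w - w₀) ^ 2) (𝓝[≠] w₀) (𝓝 (-κ)))
    (hcrit : logSinIntegral w₀ / w₀ = K) (u : ℝ) :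
    Tendsto (fun n : ℕ => n * (logSinIntegral (w₀ + u / √n) / (w₀ + u / √n) - K)) atTop
      (𝓝 (-κ * u ^ 2)) := by
  rcases eq_or_ne u 0 with rfl | hu
  · simp [hcrit]
  have hsqrt : Tendsto (fun n : ℕ => √(n : ℝ)) atTop atTop :=
    tendsto_sqrt_atTop.comp tendsto_natCast_atTop_atTop
  have hw : Tendsto (fun n : ℕ => w₀ + u / √n) atTop (𝓝[≠] w₀) := by
    refine tendsto_nhdsWithin_iff.2 ⟨by simpa using (hsqrt.const_div_atTop u).const_add w₀, ?_⟩
    filter_upwards [eventually_gt_atTop 0] with n hn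
    have : (0 : ℝ) < √n := by positivity
    simp [hu, this.ne']
  refine ((htaylor.comp hw).mul_const (u ^ 2)).congr' ?_
  filter_upwards [eventually_gt_atTop 0] with n hn
  have hnp : (0 : ℝ) < n := by exact_mod_cast hn
  simp only [Function.comp_apply, add_sub_cancel_left, div_pow, sq_sqrt hnp.le]
  field_simp

lemma exists_rate_le_quadratic (hκ : 0 < κ)
    (htaylor : Tendsto (fun w => (logSinIntegral w / w - K) / (w - w₀) ^ 2) (𝓝[≠] w₀) (𝓝 (-κ)))
    (hcrit : logSinIntegral w₀ / w₀ = K) :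
    ∃ ε > 0, ∀ w, |w - w₀| < ε → logSinIntegral w / w - K ≤ -(κ / 2) * (w - w₀) ^ 2 := by
  have h := htaylor.eventually (gt_mem_nhds (show -κ < -(κ / 2) by linarith))
  rw [eventually_nhdsWithin_iff, Metric.eventually_nhds_iff] at h
  obtain ⟨ε, hε, h⟩ := h
  refine ⟨ε, hε, fun w hw => ?_⟩
  rcases eq_or_ne w w₀ with rfl | hne
  · simp [hcrit]
  · have hsq : 0 < (w - w₀) ^ 2 := by
      have := sub_ne_zero.2 hne
      positivity
    exact ((div_lt_iff₀ hsq).1 (h hw hne)).le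

lemma tendsto_rescaled (h0 : 0 < w₀) (h1 : w₀ < 1) {w : ℕ → ℝ} (hw : Tendsto w atTop (𝓝 w₀))
    {a : ℝ} (ha : Tendsto (fun n : ℕ => n * (logSinIntegral (w n) / w n - K)) atTop (𝓝 a)) :
    Tendsto (fun n => rescaled K n (w n)) atTop (𝓝 (exp a * √(2 * (sin (π * w₀) / w₀)))) := by
  obtain ⟨b, hb0, hb1⟩ := exists_between h1
  obtain ⟨η, hη, hres⟩ := exists_rescaled_eq K (h0.trans hb0) hb1
  have hmem : ∀ᶠ n in atTop, 0 < n ∧ w n ∈ Ioc 0 b :=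
    (eventually_gt_atTop 0).and (hw.eventually (Ioc_mem_nhds h0 hb0))
  have hall : ∀ n, ∃ e, 0 < n ∧ w n ∈ Ioc 0 b → |e| ≤ η n ∧ rescaled K n (w n) =
      exp (n * (logSinIntegral (w n) / w n - K)) * √(2 * (sin (π * w n) / w n)) * exp e := by
    intro n
    by_cases h : 0 < n ∧ w n ∈ Ioc 0 b
    · obtain ⟨e, he⟩ := hres n h.1 (w n) h.2
      exact ⟨e, fun _ => he⟩
    · exact ⟨0, fun h' => absurd h' h⟩
  choose e he using hall
  have he0 : Tendsto e atTop (𝓝 0) :=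
    squeeze_zero_norm' (hmem.mono fun n hn => (he n hn).1) hη
  have hsq : ContinuousAt (fun w => √(2 * (sin (π * w) / w))) w₀ :=
    ContinuousAt.sqrt (by fun_prop (disch := exact h0.ne'))
  have hlim := ((continuous_exp.tendsto a).comp ha).mul (hsq.tendsto.comp hw) |>.mul
    ((continuous_exp.tendsto 0).comp he0)
  rw [exp_zero, mul_one] at hlim
  exact hlim.congr' (hmem.mono fun n hn => (he n hn).2.symm)

lemma arg_exp_mul_I_of_mem {θ : ℝ} (h0 : 0 ≤ θ) (h1 : θ ≤ π) :
    (Complex.exp (θ * Complex.I)).arg = θ := by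
  rw [Complex.arg_exp_mul_I, toIocMod_eq_self]
  constructor <;> linarith [pi_pos]

/-- The `n → ∞` limit of the maximum of the rescaled product. -/
theorem tendsto_circleSupNorm_div (h0 : 0 < w₀) (h1 : w₀ < 1) (hK : 0 < K)
    (hval : logSinIntegral w₀ = K * w₀)
    (hmax : ∀ s, 0 < s → s ≠ w₀ → logSinIntegral s < K * s) :
    Tendsto (fun n : ℕ => circleSupNorm (sudlerProduct n) / (exp (K * n) * √n)) atTop
      (𝓝 √(2 * (sin (π * w₀) / w₀))) := by
  set A := √(2 * (sin (π * w₀) / w₀)) with hA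
  have hA0 : 0 ≤ A := sqrt_nonneg _
  have hcrit : logSinIntegral w₀ / w₀ = K := by rw [hval]; field_simp
  refine tendsto_order.2 ⟨fun a ha => ?_, fun a ha => ?_⟩
  · have hlow : Tendsto (fun n => rescaled K n w₀) atTop (𝓝 A) := by
      have := tendsto_rescaled h0 h1 (K := K) tendsto_const_nhds (a := 0)
        (by simp [hcrit])
      rwa [exp_zero, one_mul] at this
    filter_upwards [hlow.eventually (lt_mem_nhds ha), eventually_gt_atTop 0] with n hn hn0
    refine hn.trans_le ?_
    rw [rescaled]
    gcongr
    exact le_ciSup (bddAbove_norm_sudlerProduct n) _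
  · obtain ⟨a₁, ha₁, ha₁'⟩ := exists_between ha
    obtain ⟨a₂, ha₂, ha₂'⟩ := exists_between ha₁
    have hsq : ContinuousAt (fun w => √(2 * (sin (π * w) / w))) w₀ :=
      ContinuousAt.sqrt (by fun_prop (disch := exact h0.ne'))
    obtain ⟨ε, hε, hnear⟩ := Metric.eventually_nhds_iff.1
      ((hsq.eventually (gt_mem_nhds ha₂)).and (Ioo_mem_nhds h0 (show w₀ < (w₀ + 1) / 2 by linarith)))
    obtain ⟨η, hη, hres⟩ := exists_rescaled_eq K (b := (w₀ + 1) / 2) (by linarith) (by linarith)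
    obtain ⟨δ, hδ, N, hN⟩ := exists_uniform_bound hK hval hmax hε
    have he1 : ∀ᶠ n : ℕ in atTop, a₂ * exp (η n) < a₁ := by
      have := ((continuous_exp.tendsto 0).comp hη).const_mul a₂
      rw [exp_zero, mul_one] at this
      exact this.eventually (gt_mem_nhds ha₂')
    have he2 : ∀ᶠ n : ℕ in atTop, exp (-δ * n) < a₁ := by
      have : Tendsto (fun n : ℕ => exp (-δ * n)) atTop (𝓝 0) := by
        refine tendsto_exp_atBot.comp ?_
        simp_rw [neg_mul]
        exact tendsto_neg_atTop_atBot.comp (tendsto_natCast_atTop_atTop.const_mul_atTop hδ)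
      exact this.eventually (gt_mem_nhds (by linarith))
    filter_upwards [he1, he2, eventually_ge_atTop N, eventually_gt_atTop 0] with n hn1 hn2 hnN hn0
    have hnp : (0 : ℝ) < n := by exact_mod_cast hn0
    have hM : 0 < exp (K * n) * √n := by positivity
    refine lt_of_le_of_lt ?_ ha₁'
    rw [div_le_iff₀ hM]
    refine ciSup_le fun θ => ?_
    set z := Complex.exp (θ * Complex.I) with hz
    have hz1 : ‖z‖ = 1 := Complex.norm_exp_ofReal_mul_I _
    by_cases hsep : ε ≤ |n * |z.arg| / (2 * π) - w₀|
    · rw [norm_sudlerProduct, ← hz]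
      refine (hN n hnN z hz1 hsep).trans ?_
      rw [sub_mul, sub_eq_add_neg, exp_add, ← neg_mul, mul_comm]
      have hs1 : 1 ≤ √(n : ℝ) := one_le_sqrt.2 (by exact_mod_cast hn0)
      have : exp (K * n) ≤ exp (K * n) * √n := le_mul_of_one_le_right (exp_pos _).le hs1
      exact mul_le_mul hn2.le this (exp_pos _).le (by linarith)
    · push Not at hsep
      set w := n * |z.arg| / (2 * π) with hw
      obtain ⟨hw1, hw2⟩ := hnear (y := w) hsep
      obtain ⟨e, he, heq⟩ := hres n hn0 w ⟨hw2.1, hw2.2.le⟩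
      have hθ : ‖sudlerProduct n θ‖ = ‖sudlerProduct n (2 * π * w / n)‖ := by
        have e1 : 2 * π * w / n = |z.arg| := by
          rw [hw]
          have := pi_ne_zero
          field_simp
        have e2 := Complex.norm_mul_exp_arg_mul_I z
        rw [hz1, Complex.ofReal_one, one_mul] at e2
        rw [e1, norm_sudlerProduct_abs, norm_sudlerProduct, norm_sudlerProduct, e2]
      rw [hθ, norm_sudlerProduct_eq_rescaled K hn0, mul_comm]
      gcongr
      rw [heq]
      have hrate : logSinIntegral w / w - K ≤ 0 := by
        rw [sub_nonpos, div_le_iff₀ hw2.1]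
        by_cases h : w = w₀
        · rw [h, hval]
        · exact (hmax w hw2.1 h).le
      have hexp : exp (n * (logSinIntegral w / w - K)) ≤ 1 :=
        exp_le_one_iff.2 (mul_nonpos_of_nonneg_of_nonpos hnp.le hrate)
      calc exp (n * (logSinIntegral w / w - K)) * √(2 * (sin (π * w) / w)) * exp e
          ≤ 1 * a₂ * exp (η n) := by
            have : 0 < a₂ := hA0.trans_lt ha₂
            gcongr
            exact (le_abs_self e).trans he
        _ ≤ a₁ := by rw [one_mul]; exact hn1.le

/-! ### Laplace's method for the `L^p` norm -/

lemma exists_rescaled_le_exp_neg (hK : 0 < K) (hval : logSinIntegral w₀ = K * w₀)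
    (hmax : ∀ s, 0 < s → s ≠ w₀ → logSinIntegral s < K * s) {ε : ℝ} (hε : 0 < ε) :
    ∃ δ > 0, ∀ᶠ n : ℕ in atTop, ∀ w ∈ Icc 0 ((n : ℝ) / 2), ε ≤ |w - w₀| →
      rescaled K n w ≤ exp (-δ * n) := by
  obtain ⟨δ, hδ, N, hN⟩ := exists_uniform_bound hK hval hmax hε
  refine ⟨δ, hδ, ?_⟩
  filter_upwards [eventually_ge_atTop N, eventually_gt_atTop 0] with n hnN hn0 w hw hsep
  have hnp : (0 : ℝ) < n := by exact_mod_cast hn0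
  have hθ : 0 ≤ 2 * π * w / n := div_nonneg (mul_nonneg two_pi_pos.le hw.1) hnp.le
  have harg := arg_exp_mul_I_of_mem (θ := 2 * π * w / n) hθ
    (by
      rw [div_le_iff₀ hnp]
      nlinarith [hw.2, pi_pos])
  have hb := hN n hnN _ (Complex.norm_exp_ofReal_mul_I (2 * π * w / n)) (by
    have e : n * (2 * π * w / n) / (2 * π) = w := by
      have := pi_ne_zero
      field_simp
    rwa [harg, abs_of_nonneg hθ, e])
  have hs1 : 1 ≤ √(n : ℝ) := one_le_sqrt.2 (by exact_mod_cast hn0)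
  rw [rescaled, div_le_iff₀ (by positivity), norm_sudlerProduct]
  refine hb.trans ?_
  rw [sub_mul, sub_eq_add_neg, exp_add, ← neg_mul, mul_comm]
  gcongr
  exact le_mul_of_one_le_right (exp_pos _).le hs1

/-- The contribution to the integral of an interval that avoids the peak. -/
lemma tendsto_integral_rescaled_far {p δ ε : ℝ} (hp : 1 ≤ p) (hδ : 0 < δ)
    (hfar : ∀ᶠ n : ℕ in atTop, ∀ w ∈ Icc 0 ((n : ℝ) / 2), ε ≤ |w - w₀| →
      rescaled K n w ≤ exp (-δ * n)) {a b : ℕ → ℝ}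
    (hab : ∀ᶠ n in atTop, 0 ≤ a n ∧ a n ≤ b n ∧ b n ≤ n / 2 ∧
      ∀ w ∈ Icc (a n) (b n), ε ≤ |w - w₀|) :
    Tendsto (fun n : ℕ => √n * ∫ w in (a n)..(b n), rescaled K n w ^ p) atTop (𝓝 0) := by
  have hlim := tendsto_pow_const_mul_const_pow_of_abs_lt_one 2 (r := exp (-δ))
    (by rw [abs_of_pos (exp_pos _)]; exact Real.exp_lt_one_iff.2 (by linarith))
  refine squeeze_zero_norm' ?_ hlim
  filter_upwards [hfar, hab, eventually_gt_atTop 0] with n hf ⟨ha, hle, hb, hw⟩ hn0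
  have hn1 : (1 : ℝ) ≤ n := by exact_mod_cast hn0
  have hint : ‖∫ w in (a n)..(b n), rescaled K n w ^ p‖ ≤ exp (-δ * n) * |b n - a n| := by
    refine intervalIntegral.norm_integral_le_of_norm_le_const fun w hmem => ?_
    rw [uIoc_of_le hle] at hmem
    have hmem' := Ioc_subset_Icc_self hmem
    have h1 := hf w ⟨ha.trans hmem'.1, hmem'.2.trans hb⟩ (hw w hmem')
    have h0 := rescaled_nonneg K n w
    rw [norm_of_nonneg (rpow_nonneg h0 _)]
    have hle1 : rescaled K n w ≤ 1 := h1.trans (exp_le_one_iff.2 (by nlinarith))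
    exact (rpow_le_self_of_le_one h0 hle1 hp).trans h1
  rw [norm_mul, norm_of_nonneg (sqrt_nonneg _), ← exp_nat_mul, mul_comm (n : ℝ) (-δ)]
  have hs : √(n : ℝ) ≤ n := sqrt_le_left (by linarith) |>.2 (by nlinarith)
  calc √(n : ℝ) * ‖∫ w in (a n)..(b n), rescaled K n w ^ p‖
      ≤ n * (exp (-δ * n) * |b n - a n|) := by gcongr
    _ ≤ n * (exp (-δ * n) * n) := by
      gcongr
      rw [abs_of_nonneg (by linarith)]
      linarith
    _ = (n : ℝ) ^ 2 * exp (-δ * n) := by ring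

/-- Laplace's method near the peak. -/
lemma tendsto_integral_rescaled_near {p ε : ℝ} (hp : 1 ≤ p) (hκ : 0 < κ) (h1 : w₀ < 1)
    (htaylor : Tendsto (fun w => (logSinIntegral w / w - K) / (w - w₀) ^ 2) (𝓝[≠] w₀) (𝓝 (-κ)))
    (hcrit : logSinIntegral w₀ / w₀ = K) (hε : 0 < ε) (hε0 : ε ≤ w₀ / 2) (hε1 : w₀ + ε < 1)
    (hquad : ∀ w, |w - w₀| ≤ ε → logSinIntegral w / w - K ≤ -(κ / 2) * (w - w₀) ^ 2) :
    Tendsto (fun n : ℕ => √n * ∫ w in (w₀ - ε)..(w₀ + ε), rescaled K n w ^ p) atTop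
      (𝓝 (√(2 * (sin (π * w₀) / w₀)) ^ p * √(π / (p * κ)))) := by
  have h0 : 0 < w₀ := by linarith
  have hp0 : 0 < p := by linarith
  set A := √(2 * (sin (π * w₀) / w₀)) with hA
  obtain ⟨η, hη, hres⟩ := exists_rescaled_eq K (b := w₀ + ε) (by linarith) hε1
  have hsqrt : Tendsto (fun n : ℕ => √(n : ℝ)) atTop atTop :=
    tendsto_sqrt_atTop.comp tendsto_natCast_atTop_atTop
  set f : ℕ → ℝ → ℝ := fun n => (Ioc (-(ε * √n)) (ε * √n)).indicator
    fun u => rescaled K n (w₀ + u / √n) ^ p with hf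
  have hscale : ∀ᶠ n : ℕ in atTop,
      ∫ u, f n u = √n * ∫ w in (w₀ - ε)..(w₀ + ε), rescaled K n w ^ p := by
    filter_upwards [eventually_gt_atTop 0] with n hn
    have hs : 0 < √(n : ℝ) := by positivity
    have h := intervalIntegral.integral_comp_add_div (a := -(ε * √n)) (b := ε * √n)
      (fun w => rescaled K n w ^ p) hs.ne' w₀
    rw [neg_div, mul_div_cancel_right₀ _ hs.ne', ← sub_eq_add_neg, smul_eq_mul] at h
    rw [← h, intervalIntegral.integral_of_le (by nlinarith), hf]
    exact integral_indicator measurableSet_Ioc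
  have hgauss : ∫ u : ℝ, (exp (-κ * u ^ 2) * A) ^ p = A ^ p * √(π / (p * κ)) := by
    rw [← integral_gaussian, ← integral_const_mul]
    congr 1
    funext u
    rw [mul_rpow (exp_pos _).le (sqrt_nonneg _), ← exp_mul, mul_comm]
    congr 2
    ring
  rw [← hgauss]
  refine Tendsto.congr' hscale ?_
  refine tendsto_integral_filter_of_dominated_convergence
    (fun u => (√(4 / w₀) * exp 1) ^ p * exp (-(p * (κ / 2)) * u ^ 2)) ?_ ?_ ?_ ?_
  · refine Eventually.of_forall fun n => ?_
    refine (Measurable.indicator ?_ measurableSet_Ioc).aestronglyMeasurable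
    exact (((continuous_rescaled K n).comp (by fun_prop)).measurable).pow_const p
  · filter_upwards [hη.eventually (gt_mem_nhds one_pos), eventually_gt_atTop 0] with n hn hn0
    refine Eventually.of_forall fun u => ?_
    have hs : 0 < √(n : ℝ) := by positivity
    have hnp : (0 : ℝ) < n := by exact_mod_cast hn0
    by_cases hu : u ∈ Ioc (-(ε * √n)) (ε * √n)
    · have habs : |u / √n| ≤ ε := by
        rw [abs_div, abs_of_pos hs, div_le_iff₀ hs, abs_le]
        exact ⟨hu.1.le, hu.2⟩
      have hab := abs_le.1 habs
      simp only [hf, indicator_of_mem hu]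
      set w := w₀ + u / √n with hw
      have hwlo : w₀ / 2 ≤ w := by linarith
      have hwp : 0 < w := by linarith
      obtain ⟨e, he, heq⟩ := hres n hn0 w ⟨hwp, by linarith⟩
      have hww : w - w₀ = u / √n := by rw [hw]; ring
      have hq := hquad w (by rwa [hww])
      have hexp : n * (logSinIntegral w / w - K) ≤ -(κ / 2) * u ^ 2 := by
        rw [hww, div_pow, sq_sqrt hnp.le] at hq
        calc _ ≤ n * (-(κ / 2) * (u ^ 2 / n)) := by gcongr
          _ = _ := by field_simp
      have hamp : 2 * (sin (π * w) / w) ≤ 4 / w₀ := by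
        rw [mul_div_assoc', div_le_div_iff₀ hwp h0]
        have := sin_le_one (π * w)
        nlinarith
      have hR : rescaled K n w ≤ (√(4 / w₀) * exp 1) * exp (-(κ / 2) * u ^ 2) := by
        rw [heq, mul_assoc, mul_comm]
        gcongr
        linarith [le_abs_self e]
      have hR0 := rescaled_nonneg K n w
      rw [norm_of_nonneg (rpow_nonneg hR0 _)]
      refine (rpow_le_rpow hR0 hR hp0.le).trans_eq ?_
      rw [mul_rpow (by positivity) (exp_pos _).le, ← exp_mul (-(κ / 2) * u ^ 2)]
      congr 2
      ring
    · simp only [hf, indicator_of_notMem hu, norm_zero]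
      positivity
  · exact (integrable_exp_neg_mul_sq (by positivity)).const_mul _
  · refine Eventually.of_forall fun u => ?_
    have hw : Tendsto (fun n : ℕ => w₀ + u / √n) atTop (𝓝 w₀) := by
      simpa using (hsqrt.const_div_atTop u).const_add w₀
    have hlim := (tendsto_rescaled h0 h1 hw (tendsto_mul_rate_sub htaylor hcrit u)).rpow_const
      (p := p) (Or.inr hp0.le)
    refine hlim.congr' ?_
    filter_upwards [(hsqrt.const_mul_atTop hε).eventually_gt_atTop |u|] with n hn
    have := abs_lt.1 hn
    have hu : u ∈ Ioc (-(ε * √n)) (ε * √n) := ⟨this.1, this.2.le⟩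
    simp only [hf, indicator_of_mem hu]

theorem tendsto_integral_rescaled {p : ℝ} (hp : 1 ≤ p) (hκ : 0 < κ) (h0 : 0 < w₀) (h1 : w₀ < 1)
    (hK : 0 < K) (hval : logSinIntegral w₀ = K * w₀)
    (hmax : ∀ s, 0 < s → s ≠ w₀ → logSinIntegral s < K * s)
    (htaylor : Tendsto (fun w => (logSinIntegral w / w - K) / (w - w₀) ^ 2) (𝓝[≠] w₀)
      (𝓝 (-κ))) :
    Tendsto (fun n : ℕ => √n * ∫ w in (0 : ℝ)..(n / 2), rescaled K n w ^ p) atTop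
      (𝓝 (√(2 * (sin (π * w₀) / w₀)) ^ p * √(π / (p * κ)))) := by
  have hcrit : logSinIntegral w₀ / w₀ = K := by rw [hval]; field_simp
  obtain ⟨ε', hε', hquad⟩ := exists_rate_le_quadratic hκ htaylor hcrit
  obtain ⟨ε, hε, hmin⟩ : ∃ ε > 0, ε < ε' ∧ ε ≤ w₀ / 2 ∧ w₀ + ε < 1 := by
    refine ⟨min (ε' / 2) (min (w₀ / 2) ((1 - w₀) / 2)), ?_, ?_, ?_, ?_⟩
    · have : 0 < 1 - w₀ := by linarith
      positivity
    · exact (min_le_left _ _).trans_lt (by linarith)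
    · exact (min_le_right _ _).trans (min_le_left _ _)
    · have : min (ε' / 2) (min (w₀ / 2) ((1 - w₀) / 2)) ≤ (1 - w₀) / 2 :=
        (min_le_right _ _).trans (min_le_right _ _)
      linarith
  obtain ⟨δ, hδ, hfar⟩ := exists_rescaled_le_exp_neg hK hval hmax hε
  have hlarge : ∀ᶠ n : ℕ in atTop, w₀ + ε ≤ (n : ℝ) / 2 := by
    filter_upwards [eventually_ge_atTop 2] with n hn
    have : (2 : ℝ) ≤ n := by exact_mod_cast hn
    linarith [hmin.2.2]
  have hA := tendsto_integral_rescaled_far hp hδ hfar (a := fun _ => 0) (b := fun _ => w₀ - ε) (by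
    filter_upwards [hlarge] with n hn
    refine ⟨le_rfl, by linarith [hmin.2.1], by linarith, fun w hw => ?_⟩
    rw [abs_of_nonpos (by linarith [hw.2])]
    linarith [hw.2])
  have hB := tendsto_integral_rescaled_near hp hκ h1 htaylor hcrit hε hmin.2.1 hmin.2.2
    fun w hw => hquad w (hw.trans_lt hmin.1)
  have hC := tendsto_integral_rescaled_far hp hδ hfar (a := fun _ => w₀ + ε)
    (b := fun n => (n : ℝ) / 2) (by
      filter_upwards [hlarge] with n hn
      refine ⟨by linarith, hn, le_rfl, fun w hw => ?_⟩
      rw [abs_of_nonneg (by linarith [hw.1])]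
      linarith [hw.1])
  have hsum := (hA.add hB).add hC
  rw [zero_add, add_zero] at hsum
  refine hsum.congr fun n => ?_
  have hint : ∀ a b : ℝ, IntervalIntegrable (fun w => rescaled K n w ^ p) volume a b :=
    fun a b => ((continuous_rescaled K n).rpow_const fun _ => Or.inr (by linarith))
      |>.intervalIntegrable a b
  rw [← mul_add, ← mul_add, intervalIntegral.integral_add_adjacent_intervals (hint _ _) (hint _ _),
    intervalIntegral.integral_add_adjacent_intervals (hint _ _) (hint _ _)]

lemma circleLpNorm_sudlerProduct (K : ℝ) {p : ℝ} (hp : 1 ≤ p) {n : ℕ} (hn : 0 < n) :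
    circleLpNorm p (sudlerProduct n) =
      (2 / (n : ℝ) ^ (3 / 2 : ℝ)) ^ (1 / p) *
        (√n * ∫ w in (0 : ℝ)..(n / 2), rescaled K n w ^ p) ^ (1 / p) * (exp (K * n) * √n) := by
  have hnp : (0 : ℝ) < n := by exact_mod_cast hn
  have hp0 : 0 < p := by linarith
  set M := exp (K * n) * √n with hM
  have hMpos : 0 < M := by positivity
  set h : ℝ → ℝ := fun θ => ‖sudlerProduct n θ‖ ^ p with hh
  have hcont : Continuous h :=
    (continuous_norm_sudlerProduct n).rpow_const fun _ => Or.inr hp0.le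
  have hper : Function.Periodic h (2 * π) := fun θ => by
    simp only [hh]
    rw [show ‖sudlerProduct n (θ + 2 * π)‖ = ‖sudlerProduct n θ‖ from
      periodic_norm_sudlerProduct n θ]
  have hsym : ∫ θ in (0 : ℝ)..(2 * π), h θ = 2 * ∫ θ in (0 : ℝ)..π, h θ := by
    have e1 := hper.intervalIntegral_add_eq 0 (-π)
    have e2 := intervalIntegral.integral_comp_neg (a := 0) (b := π) h
    have e3 : (fun θ => h (-θ)) = h := by
      funext θ
      simp only [hh]
      rw [norm_sudlerProduct_neg]
    simp only [e3, neg_zero] at e2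
    rw [zero_add, show -π + 2 * π = π by ring] at e1
    rw [e1, ← intervalIntegral.integral_add_adjacent_intervals (hcont.intervalIntegrable (-π) 0)
      (hcont.intervalIntegrable 0 π), ← e2, two_mul]
  have hresc : ∫ w in (0 : ℝ)..(n / 2), rescaled K n w ^ p =
      (M ^ p)⁻¹ * (n / (2 * π) * ∫ θ in (0 : ℝ)..π, h θ) := by
    have e1 : ∀ w, rescaled K n w ^ p = (M ^ p)⁻¹ * h (2 * π / n * w) := by
      intro w
      rw [rescaled, div_rpow (norm_nonneg _) hMpos.le, div_eq_inv_mul]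
      simp only [hh]
      congr 4
      ring
    simp_rw [e1]
    rw [intervalIntegral.integral_const_mul,
      intervalIntegral.integral_comp_mul_left h (by positivity), mul_zero, smul_eq_mul, inv_div]
    rw [show 2 * π / n * (n / 2 : ℝ) = π by field_simp]
  have hI : 0 ≤ ∫ w in (0 : ℝ)..(n / 2), rescaled K n w ^ p :=
    intervalIntegral.integral_nonneg (by positivity) fun w _ =>
      rpow_nonneg (rescaled_nonneg K n w) _
  have hpow : (n : ℝ) ^ (3 / 2 : ℝ) = n * √n := by
    rw [sqrt_eq_rpow, ← rpow_one_add' hnp.le (by norm_num)]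
    norm_num
  have hbase : 1 / (2 * π) * ∫ θ in (0 : ℝ)..(2 * π), h θ =
      2 / (n : ℝ) ^ (3 / 2 : ℝ) * (√n * ∫ w in (0 : ℝ)..(n / 2), rescaled K n w ^ p) * M ^ p := by
    rw [hsym, hresc, hpow]
    have h1 : M ^ p ≠ 0 := (rpow_pos_of_pos hMpos p).ne'
    have h2 : √(n : ℝ) ≠ 0 := by positivity
    field_simp
  rw [circleLpNorm, hbase, mul_rpow (by positivity) (by positivity),
    mul_rpow (by positivity) (by positivity), ← rpow_mul hMpos.le, mul_one_div_cancel hp0.ne',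
    rpow_one]

/-- The constant `B C (n / 4π)^{1/2}` of the asymptotic formula in terms of `sin (πw₀)`. -/
lemma const_mul_rpow_eq {s c C : ℝ} (hs : 0 < s) (hc : 0 < c) (hC : 0 < C) (h0 : 0 < w₀)
    (hC2 : C ^ 2 = 1 / 2 * (π / w₀) * (c / s)) (n : ℕ) :
    2 * (2 * s) * (c ^ 2) ^ (-(1 / 4) : ℝ) * C * ((n : ℝ) / (4 * π)) ^ (1 / 2 : ℝ) =
      √(2 * (s / w₀)) * √n := by
  have hc4 : ((c ^ 2) ^ (-(1 / 4) : ℝ)) ^ 2 = c⁻¹ := by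
    rw [← rpow_natCast c 2, ← rpow_natCast (_ ^ _) 2, ← rpow_mul (by positivity),
      ← rpow_mul hc.le, ← rpow_neg_one]
    norm_num
  rw [← sqrt_eq_rpow, ← pow_left_inj₀ (by positivity) (by positivity) two_ne_zero, mul_pow, mul_pow,
    mul_pow, hc4, hC2, sq_sqrt (by positivity), mul_pow √(2 * (s / w₀)),
    sq_sqrt (by positivity), sq_sqrt (by positivity)]
  have := pi_ne_zero
  field_simp
  ring

end Sudler

open Sudler in
theorem theorem2 :
    ∃ w₀ : ℝ, w₀ ∈ Ioo (0 : ℝ) 1 ∧ IsMaxOn meanLogSin (Ioo (0 : ℝ) 1) w₀ ∧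
      (∀ w ∈ Ioo (0 : ℝ) 1, IsMaxOn meanLogSin (Ioo (0 : ℝ) 1) w → w = w₀) ∧
      ∃ K B C : ℝ,
        K = Real.log 2 + meanLogSin w₀ ∧
        0 < 1 - (1 / 4) * Real.exp (2 * K) ∧
        B = 2 * Real.exp K * (1 - (1 / 4) * Real.exp (2 * K)) ^ (-(1 / 4) : ℝ) ∧
        0 < C ∧
        C ^ 2 = -(1 / 2) * (Real.pi / w₀) * Real.cot (Real.pi * w₀) ∧
        (∀ p : ℝ, 1 ≤ p →
          (fun n : ℕ => circleLpNorm p (sudlerProduct n)) ~[atTop]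
            fun n : ℕ =>
              (2 * (Real.pi ^ (1 / 2 : ℝ) / (C * p ^ (1 / 2 : ℝ) * (n : ℝ) ^ (3 / 2 : ℝ)))) ^ (1 / p) *
                (Real.exp (K * n) * B * C * ((n : ℝ) / (4 * Real.pi)) ^ (1 / 2 : ℝ))) ∧
        (fun n : ℕ => circleSupNorm (sudlerProduct n)) ~[atTop]
          fun n : ℕ => Real.exp (K * n) * B * C * ((n : ℝ) / (4 * Real.pi)) ^ (1 / 2 : ℝ) := by
  obtain ⟨w₀, K, hw0, hw1, hK, hKsin, hval, hmax⟩ := exists_rate_max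
  have h0 : 0 < w₀ := by linarith
  have h1 : w₀ < 1 := by linarith
  have hs := sin_pi_mul_pos h0 h1
  have hcot := cot_pi_mul_neg hw0 h1
  have hKmean : K = Real.log 2 + meanLogSin w₀ := by
    rw [log_two_add_meanLogSin h0 h1, hval]
    field_simp
  have hlt : ∀ w ∈ Ioo (0 : ℝ) 1, w ≠ w₀ → meanLogSin w < meanLogSin w₀ := by
    intro w hw hne
    have h2 := log_two_add_meanLogSin hw.1 hw.2
    have h3 := (div_lt_iff₀ hw.1).2 (hmax w hw.1 hne)
    linarith
  have hmem : w₀ ∈ Ioo (0 : ℝ) 1 := ⟨h0, h1⟩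
  have hC0 : 0 < -(1 / 2) * (Real.pi / w₀) * Real.cot (Real.pi * w₀) := by
    have h2 : 0 < Real.pi / w₀ := div_pos Real.pi_pos h0
    nlinarith
  set κ := -(1 / 2) * (Real.pi / w₀) * Real.cot (Real.pi * w₀) with hκ
  set s := Real.sin (Real.pi * w₀) with hsdef
  set c := -Real.cos (Real.pi * w₀) with hcdef
  have hcpos : 0 < c := by
    rw [Real.cot_eq_cos_div_sin] at hcot
    have := (div_neg_iff.1 hcot).resolve_left fun h => h.2.not_gt hs
    rw [hcdef]
    linarith [this.1]
  have hexpK : Real.exp K = 2 * s := by rw [hKsin, Real.exp_log (by positivity)]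
  have hcos : 1 - (1 / 4) * Real.exp (2 * K) = c ^ 2 := by
    rw [two_mul, Real.exp_add, hexpK, hcdef, neg_sq, Real.cos_sq']
    ring
  have hC2 : Real.sqrt κ ^ 2 = κ := Real.sq_sqrt hC0.le
  have hCpos : 0 < Real.sqrt κ := Real.sqrt_pos.2 hC0
  have htaylor := tendsto_rate_sub_div_sq hw0 h1 hKsin hval
  rw [show Real.pi / w₀ * Real.cot (Real.pi * w₀) / 2 = -κ by rw [hκ]; ring] at htaylor
  set A := Real.sqrt (2 * (s / w₀)) with hA
  have hA0 : 0 < A := by positivity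
  have hconst : ∀ n : ℕ, Real.exp (K * n) * (2 * Real.exp K *
      (1 - (1 / 4) * Real.exp (2 * K)) ^ (-(1 / 4) : ℝ)) * Real.sqrt κ *
      ((n : ℝ) / (4 * Real.pi)) ^ (1 / 2 : ℝ) = A * (Real.exp (K * n) * Real.sqrt n) := by
    intro n
    have h2 := const_mul_rpow_eq hs hcpos hCpos h0 (by
      rw [hC2, hκ, Real.cot_eq_cos_div_sin, hcdef, ← hsdef]
      ring) n
    rw [hcos, hexpK, mul_left_comm A, ← h2]
    ring
  refine ⟨w₀, hmem, fun w hw => ?_, fun w hw hwmax => ?_, K, _, Real.sqrt κ, hKmean,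
    ?_, rfl, hCpos, hC2, fun p hp => ?_, ?_⟩
  · rcases eq_or_ne w w₀ with rfl | hne
    · exact le_refl (meanLogSin w)
    · exact (hlt w hw hne).le
  · by_contra hne
    exact (hlt w hw hne).not_ge (hwmax hmem)
  · rw [hcos]
    positivity
  · have hp0 : 0 < p := by linarith
    have hlim := (tendsto_integral_rescaled hp hC0 h0 h1 hK hval hmax htaylor).rpow_const
      (p := 1 / p) (Or.inr (by positivity))
    rw [← hsdef, ← hA] at hlim
    set J := A ^ p * Real.sqrt (Real.pi / (p * κ)) with hJ
    have hJpos : 0 < J := by positivity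
    have heq : (fun n : ℕ => (2 / (n : ℝ) ^ (3 / 2 : ℝ)) ^ (1 / p) *
        (Real.sqrt n * ∫ w in (0 : ℝ)..(n / 2), rescaled K n w ^ p) ^ (1 / p) *
          (Real.exp (K * n) * Real.sqrt n)) ~[atTop]
        fun n : ℕ => (2 / (n : ℝ) ^ (3 / 2 : ℝ)) ^ (1 / p) * J ^ (1 / p) *
          (Real.exp (K * n) * Real.sqrt n) :=
      (IsEquivalent.refl.mul ((isEquivalent_const_iff_tendsto
        (Real.rpow_pos_of_pos hJpos _).ne').2 hlim)).mul IsEquivalent.refl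
    refine (heq.congr_left ?_).congr_right ?_
    · filter_upwards [eventually_gt_atTop 0] with n hn
      exact (circleLpNorm_sudlerProduct K hp hn).symm
    · filter_upwards [eventually_gt_atTop 0] with n hn
      have hnp : (0 : ℝ) < n := by exact_mod_cast hn
      have hn32 : 0 < (n : ℝ) ^ (3 / 2 : ℝ) := Real.rpow_pos_of_pos hnp _
      have hJp : J ^ (1 / p) = A * (Real.sqrt (Real.pi / (p * κ))) ^ (1 / p) := by
        rw [hJ, Real.mul_rpow (by positivity) (Real.sqrt_nonneg _), ← Real.rpow_mul hA0.le,
          mul_one_div_cancel hp0.ne', Real.rpow_one]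
      have hbase : 2 * (Real.pi ^ (1 / 2 : ℝ) /
          (Real.sqrt κ * p ^ (1 / 2 : ℝ) * (n : ℝ) ^ (3 / 2 : ℝ))) =
          2 / (n : ℝ) ^ (3 / 2 : ℝ) * Real.sqrt (Real.pi / (p * κ)) := by
        rw [Real.sqrt_div Real.pi_pos.le, Real.sqrt_mul hp0.le, ← Real.sqrt_eq_rpow,
          ← Real.sqrt_eq_rpow]
        field_simp
      rw [hconst, hbase, hJp, Real.mul_rpow (by positivity) (Real.sqrt_nonneg _)]
      ring
  · have hlim := tendsto_circleSupNorm_div h0 h1 hK hval hmax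
    rw [← hsdef, ← hA] at hlim
    simp_rw [hconst]
    have h2 := ((isEquivalent_const_iff_tendsto hA0.ne').2 hlim).mul
      (IsEquivalent.refl (u := fun n : ℕ => Real.exp (K * n) * Real.sqrt n))
    refine h2.congr_left ?_
    filter_upwards [eventually_gt_atTop 0] with n hn
    have hnp : (0 : ℝ) < n := by exact_mod_cast hn
    simp only [Pi.mul_apply]
    field_simp
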